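/- Let $(\Omega,\mathscr{F},\mathbb{P})$ be a probability space with a discrete filtration $(\mathscr{F}_t)_{t=0,\ldots,T}$, $T \in \mathbb{N}$, $\mathscr{F}_0 = \{\Omega,\emptyset\}$, and let $\mathbb{S} = \{S^1,\ldots,S^d\}$ be a finite market of (almost surely) nonnegative adapted real-valued processes $(S^i_t)_{t=0,\ldots,T}$. No asset is assumed to be strictly positive. A process $X$ is \emph{predictable} if $X_0$ is $\mathscr{F}_0$-measurable and $X_t$ is $\mathscr{F}_{t-1}$-measurable for $t=1,\ldots,T$. A \emph{savings account} is a predictable process $B$ with $B_0 = 1$ and $B_t > 0$ for all $t$. For a finite market $\mathbb{X} = \{X^1,\ldots,X^n\}$, a \emph{self-financing strategy} is an $\mathbb{R}^n$-valued predictable process $\delta$ such that, almost surely, for all $t = 0,\ldots,T$, $$\delta_t \cdot X_t = \delta_0 \cdot X_0 + \sum_{k=1}^t \delta_k \cdot (X_k - X_{k-1}),$$ and $\mathscr{P}_{\mathrm{sf},0}(\mathbb{X}) \subset L^0$ denotes the set of all terminal values $\delta_T \cdot X_T$ of self-financing strategies $\delta$ with $\delta_0 \cdot X_0 = 0$. A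 set $\mathscr{K} \subset L^0$ \emph{satisfies NA} if $\mathscr{K} \cap L^0_+ = \{0\}$. An \emph{equivalent martingale deflator (EMD)} for $\mathbb{S}$ is an adapted process $Z > 0$ such that $S^i Z$ is a $\mathbb{P}$-martingale for every $i$. A process $Z > 0$ is a \emph{multiplicative special semimartingale} if $Z = DC$ almost surely with a local martingale $D > 0$ (the \emph{local martingale part}, unique up to a positive constant factor and null sets) and a predictable process $C > 0$. For a savings account $B$, an \emph{equivalent martingale measure (EMM)} for $\mathbb{S}B^{-1} = \{S^1 B^{-1},\ldots,S^d B^{-1}\}$ is a probability measure $\mathbb{Q}$ on $(\Omega,\mathscr{F}_T)$, equivalent to $\mathbb{P}|_{\mathscr{F}_T}$, such that $S^i B^{-1}$ is a $\mathbb{Q}$-martingale for every $i$. Then the following statements are equivalent: (i) There exists a savings account $B$ such that $\mathscr{P}_{\mathrm{sf},0}(\mathbb{S} \cup \{B\})$ satisfies NA. (ii) There exists an EMD $Z$ for $\mathbb{S}$ which is a multiplicative special semimartingale such that the local martingale part $D$ is a true $\mathbb{P}$-martingale. (iii) There exist a savings account $B$ and an EMM $\mathbb{Q} \approx \mathbb{P}$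 on $(\Omega,\mathscr{F}_T)$ for $\mathbb{S} B^{-1}$. -/

import Mathlib

open MeasureTheory ProbabilityTheory

namespace DiscreteMarket

variable {Ω : Type*} {m : MeasurableSpace Ω} {T : ℕ} {ι : Type*}

/-- The filtration `(ℱ_t)_{t = 0, …, T}`, seen as a filtration on `(Ω, ℱ_T)`. -/
def terminalFiltration (ℱ : Filtration (Fin (T + 1)) m) :
    Filtration (Fin (T + 1)) (ℱ (Fin.last T)) where
  seq := fun t => ℱ t
  mono' := fun _ _ h => ℱ.mono h
  le' := fun t => ℱ.mono (Fin.le_last t)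

/-- A savings account: a predictable, strictly positive process with `B_0 = 1`.
In discrete time every process has càdlàg paths of finite variation, and `B > 0` contains
`B_- > 0`. -/
structure IsSavingsAccount (ℱ : Filtration (Fin (T + 1)) m) (B : Fin (T + 1) → Ω → ℝ) :
    Prop where
  predictable : IsStronglyPredictable ℱ B
  init : ∀ ω, B 0 ω = 1
  pos : ∀ t ω, 0 < B t ω

/-- The market `𝕊 ∪ {B}`; the index `none` belongs to `B`. -/
def addAsset (S : ι → Fin (T + 1) → Ω → ℝ) (B : Fin (T + 1) → Ω → ℝ) :
    Option ι → Fin (T + 1) → Ω → ℝ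
  | none => B
  | some i => S i

/-- The market `𝕊 B⁻¹`. -/
noncomputable def discounted (S : ι → Fin (T + 1) → Ω → ℝ) (B : Fin (T + 1) → Ω → ℝ) :
    ι → Fin (T + 1) → Ω → ℝ :=
  fun i t ω => S i t ω * (B t ω)⁻¹

/-- The portfolio value `S^δ_t = δ_t · S_t`. -/
def portfolio [Fintype ι] (S δ : ι → Fin (T + 1) → Ω → ℝ) (t : Fin (T + 1)) (ω : Ω) : ℝ :=
  ∑ i, δ i t ω * S i t ω

/-- The discrete stochastic integral `∑_{k = 1}^t δ_k · (S_k - S_{k-1})`. -/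
def stochInt [Fintype ι] (δ S : ι → Fin (T + 1) → Ω → ℝ) (t : Fin (T + 1)) (ω : Ω) : ℝ :=
  ∑ k : Fin T with k.succ ≤ t, ∑ i, δ i k.succ ω * (S i k.succ ω - S i k.castSucc ω)

/-- Self-financing strategies: predictable `δ` such that almost surely
`S^δ_t = S^δ_0 + ∑_{k = 1}^t δ_k · (S_k - S_{k-1})` for all `t`. -/
structure IsSelfFinancing [Fintype ι] (ℱ : Filtration (Fin (T + 1)) m) (P : Measure Ω)
    (S δ : ι → Fin (T + 1) → Ω → ℝ) : Prop where
  predictable : ∀ i, IsStronglyPredictable ℱ (δ i)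
  selfFinancing : ∀ t, portfolio S δ t =ᵐ[P] fun ω => portfolio S δ 0 ω + stochInt δ S t ω

/-- The set of terminal values, as elements of `L⁰`, of the self-financing portfolios with
initial value `α`. -/
def sfOutcomes [Fintype ι] (ℱ : Filtration (Fin (T + 1)) m) (P : Measure Ω)
    (S : ι → Fin (T + 1) → Ω → ℝ) (α : ℝ) : Set (Ω →ₘ[P] ℝ) :=
  {f | ∃ δ, IsSelfFinancing ℱ P S δ ∧ (∀ᵐ ω ∂P, portfolio S δ 0 ω = α) ∧
    f =ᵐ[P] portfolio S δ (Fin.last T)}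

/-- No Arbitrage for a set of outcomes: `K ∩ L⁰_+ = {0}`. -/
def SatisfiesNA {P : Measure Ω} (K : Set (Ω →ₘ[P] ℝ)) : Prop :=
  K ∩ {f | 0 ≤ f} = {0}

/-- `Z` is an equivalent martingale deflator for the processes `X i`. In discrete time
semimartingales are the adapted processes. -/
structure IsEMD (ℱ : Filtration (Fin (T + 1)) m) (P : Measure Ω)
    (X : ι → Fin (T + 1) → Ω → ℝ) (Z : Fin (T + 1) → Ω → ℝ) : Prop where
  adapted : StronglyAdapted ℱ Z
  pos : ∀ t ω, 0 < Z t ω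
  martingale : ∀ i, Martingale (fun t ω => X i t ω * Z t ω) ℱ P

/-- `Z = D C` is a multiplicative decomposition of `Z`: the process `D > 0` is a local martingale
and `C > 0` is predictable (and of finite variation, which is automatic in discrete time). -/
structure IsMultiplicativeDecomposition (ℱ : Filtration (Fin (T + 1)) m) (P : Measure Ω)
    (Z D C : Fin (T + 1) → Ω → ℝ) : Prop where
  localMartingale : Locally (fun X => Martingale X ℱ P) ℱ D P
  pos_left : ∀ t ω, 0 < D t ω
  predictable : IsStronglyPredictable ℱ C
  pos_right : ∀ t ω, 0 < C t ω
  eq_mul : ∀ t, Z t =ᵐ[P] fun ω => D t ω * C t ω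

/-- `Q` is an equivalent martingale measure on `(Ω, ℱ_T)` for the processes `X i`. -/
structure IsEMM (ℱ : Filtration (Fin (T + 1)) m) (P : Measure Ω)
    (X : ι → Fin (T + 1) → Ω → ℝ) (Q : @Measure Ω (ℱ (Fin.last T))) : Prop where
  prob : IsProbabilityMeasure Q
  ac : Q ≪ P.trim (ℱ.le (Fin.last T))
  ac_symm : P.trim (ℱ.le (Fin.last T)) ≪ Q
  martingale : ∀ i, Martingale (X i) (terminalFiltration ℱ) Q

end DiscreteMarket

/-!
Discounting by the savings account `B` turns the theorem into the Dalang–Morton–Willinger theorem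
for nonnegative prices, plus Bayes' rule.

*Change of measure.* A positive martingale `D` with `D₀ = 1` is the density process of an equivalent
probability measure `Q` on `ℱ_T`, and conversely; by Bayes' rule `M` is a `Q`-martingale if and only
if `M D` is a `P`-martingale (`exists_measure_of_martingale`, `martingale_terminalFiltration_iff`).
Since `ℱ_0` is trivial, `C_0` and `D_0` are constants for a multiplicative decomposition `Z = D C`.
So `B = C_0 / C` and the density process `D / D_0` correspond to the deflator `Z = D B⁻¹`, up to
constants. This links the second and the third statement.

*A martingale measure excludes arbitrage.* For discounted self-financing wealth, nonnegativity at
time `T` propagates backwards, one period at a time, and vanishing at time `0` then propagates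
forwards (`ae_wealth_eq_zero`). Localising on sets where the position is bounded avoids any
integrability of the strategy (`ae_nonneg_and_gain_eq_zero`).

*No arbitrage gives a martingale measure.* A one-period arbitrage extends to a self-financing
strategy by putting the gain into the savings account (`ae_gain_eq_zero_of_satisfiesNA`), so every
period is free of arbitrage. For each period the one-period theorem `exists_one_period_density`
gives a conditional density that prices all assets. Since prices are nonnegative and `S_0` is
constant, the product of these densities makes all prices integrable and solves the problem
(`exists_martingale_density`).

*The one-period theorem.* Scale the increment `Y` to be bounded, and minimise the exponential
disutility `E[exp (-ξ · Y)]` over `F`-measurable positions `ξ`. The functions `exp (-ξ_k · Y / 2)`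
of a minimising sequence are Cauchy in `L²`, because the scalar product of two of them is the value
at the midpoint; the square of their limit `u` satisfies the first-order condition `E[u² Y | F] = 0`
even if the positions diverge (`exists_exponential_minimiser`, `integral_gain_eq_zero_of_minimal`).
What remains is `u > 0`, and here absence of arbitrage enters (`ae_ne_zero_of_tendsto_exp`). Where
`u = 0`, the positions diverge, while their losses stay bounded. Choose the positions orthogonal
to those with zero gain; then weak limits of the normalised positions are arbitrages unless they
vanish. Applied to the normalised positions and to their products with their own coordinates, this
shows that their coordinates tend to `0` in mean square, although their norms tend to `1` on the set
of divergence, which is therefore null. Only deterministic weak compactness in a Hilbert space is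
used, so no measurable selection is needed.
-/

namespace DiscreteMarket

open Filter Topology

/-! ### Convexity and weak compactness in Hilbert spaces; multiplication operators -/

section Hilbert

variable {H : Type*} [NormedAddCommGroup H] [InnerProductSpace ℝ H] [CompleteSpace H]

/-- The weak compactness of bounded closed convex sets, for decreasing sequences: the points of
minimal norm converge. -/
lemma nonempty_iInter_of_antitone_convex {K : ℕ → Set H} (hanti : Antitone K)
    (hconv : ∀ n, Convex ℝ (K n)) (hclosed : ∀ n, IsClosed (K n)) (hne : ∀ n, (K n).Nonempty)
    {R : ℝ} (hR : ∀ n, ∀ x ∈ K n, ‖x‖ ≤ R) : (⋂ n, K n).Nonempty := by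
  choose x hxK hx using fun n =>
    exists_norm_eq_iInf_of_complete_convex (hne n) (hclosed n).isComplete (hconv n) (0 : H)
  have hmin : ∀ n, ∀ y ∈ K n, ‖x n‖ ≤ ‖y‖ := by
    intro n y hy
    have h1 : (⨅ w : K n, ‖(0 : H) - w‖) ≤ ‖(0 : H) - y‖ :=
      ciInf_le ⟨0, by rintro _ ⟨w, rfl⟩; exact norm_nonneg _⟩ (⟨y, hy⟩ : K n)
    rw [← hx n] at h1
    simpa using h1
  have hmono : Monotone fun n => ‖x n‖ ^ 2 := fun n k hnk => by
    have := hmin n (x k) (hanti hnk (hxK k))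
    dsimp only
    gcongr
  have hbdd : BddAbove (Set.range fun n => ‖x n‖ ^ 2) := by
    refine ⟨R ^ 2, ?_⟩
    rintro _ ⟨n, rfl⟩
    have := hR n _ (hxK n)
    dsimp only
    gcongr
  have hlim := tendsto_atTop_ciSup hmono hbdd
  have hdist : ∀ n k, n ≤ k → ‖x n - x k‖ ^ 2 ≤ 2 * (‖x k‖ ^ 2 - ‖x n‖ ^ 2) := by
    intro n k hnk
    have hp := parallelogram_law_with_norm ℝ (x n) (x k)
    have hmid : (1 / 2 : ℝ) • x n + (1 / 2 : ℝ) • x k ∈ K n :=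
      hconv n (hxK n) (hanti hnk (hxK k)) (by norm_num) (by norm_num) (by norm_num)
    have h2 := hmin n _ hmid
    rw [← smul_add, norm_smul] at h2
    have h3 : 2 * ‖x n‖ ≤ ‖x n + x k‖ := by
      rw [Real.norm_of_nonneg (by norm_num)] at h2
      linarith
    have h4 := norm_nonneg (x n)
    nlinarith
  have hcauchy : CauchySeq x := by
    rw [Metric.cauchySeq_iff']
    intro ε hε
    obtain ⟨N, hN⟩ := Metric.cauchySeq_iff'.1 hlim.cauchySeq (ε ^ 2 / 2) (by positivity)
    refine ⟨N, fun n hn => ?_⟩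
    have h1 := hN n hn
    rw [Real.dist_eq] at h1
    have h2 := hdist N n hn
    have h3 := (le_abs_self _).trans_lt h1
    rw [dist_comm, dist_eq_norm]
    refine lt_of_pow_lt_pow_left₀ 2 hε.le ?_
    linarith
  obtain ⟨y, hy⟩ := cauchySeq_tendsto_of_complete hcauchy
  refine ⟨y, Set.mem_iInter.2 fun n => (hclosed n).mem_of_tendsto hy ?_⟩
  filter_upwards [eventually_ge_atTop n] with k hk using hanti hk (hxK k)

/-- If the convex function `φ` is positive off `N`, then on bounded subsets of `Nᗮ` the values of
`φ` control the vector weakly: `φ ζ → 0` forces `ζ → 0` weakly. -/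
lemma exists_forall_inner_lt_of_convexOn {φ : H → ℝ} (hφ : ConvexOn ℝ Set.univ φ)
    (hcont : Continuous φ) {N : Submodule ℝ H} (hN : ∀ ξ, φ ξ ≤ 0 → ξ ∈ N) (v : H) (R : ℝ)
    {δ : ℝ} (hδ : 0 < δ) :
    ∃ ε > 0, ∀ ζ ∈ Nᗮ, ‖ζ‖ ≤ R → φ ζ ≤ ε → inner ℝ v ζ < δ := by
  by_contra! hcon
  let K : ℕ → Set H := fun n =>
    ((Nᗮ : Submodule ℝ H) : Set H) ∩ (Metric.closedBall 0 R ∩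
      ({ζ ∈ Set.univ | φ ζ ≤ 1 / ((n : ℝ) + 1)} ∩ {ζ | δ ≤ inner ℝ v ζ}))
  have hne : (⋂ n, K n).Nonempty := by
    refine nonempty_iInter_of_antitone_convex (R := R) ?_ ?_ ?_ ?_ ?_
    · rintro n k hnk ζ ⟨h1, h2, ⟨-, h3⟩, h4⟩
      refine ⟨h1, h2, ⟨trivial, h3.trans ?_⟩, h4⟩
      gcongr
    · intro n
      refine (Submodule.convex _).inter ((convex_closedBall _ _).inter
        ((hφ.convex_le _).inter ?_))
      exact convex_halfSpace_ge (innerₛₗ ℝ v).isLinear δ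
    · intro n
      refine (Submodule.isClosed_orthogonal N).inter (Metric.isClosed_closedBall.inter
        (IsClosed.inter ?_ ?_))
      · simpa using isClosed_le hcont continuous_const
      · exact isClosed_le continuous_const (by fun_prop)
    · intro n
      obtain ⟨ζ, h1, h2, h3, h4⟩ := hcon (1 / ((n : ℝ) + 1)) (by positivity)
      exact ⟨ζ, h1, by simpa using h2, ⟨trivial, h3⟩, h4⟩
    · rintro n ζ ⟨-, h, -⟩
      simpa using h
  obtain ⟨ζ, hζ⟩ := hne
  rw [Set.mem_iInter] at hζ
  have h1 : φ ζ ≤ 0 := ge_of_tendsto' tendsto_one_div_add_atTop_nhds_zero_nat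
    fun n => (hζ n).2.2.1.2
  have h2 : inner ℝ ζ ζ = 0 := (hζ 0).1 ζ (hN ζ h1)
  rw [inner_self_eq_zero] at h2
  have h3 : δ ≤ inner ℝ v ζ := (hζ 0).2.2.2
  rw [h2, inner_zero_right] at h3
  linarith

lemma exists_eq_add_of_isClosed {N : Submodule ℝ H} (hN : IsClosed (N : Set H)) (ξ : H) :
    ∃ ν ∈ N, ∃ ζ ∈ Nᗮ, ξ = ν + ζ := by
  have : CompleteSpace N := hN.completeSpace_coe
  exact N.exists_add_mem_mem_orthogonal ξ

end Hilbert

section MulL2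

variable {Ω E : Type*} {m : MeasurableSpace Ω} {μ : Measure Ω} [NormedAddCommGroup E]
  [InnerProductSpace ℝ E] {a : Ω → ℝ} {C : ℝ}

lemma memLp_smul_of_bounded (ha : StronglyMeasurable a) (hC : ∀ ω, |a ω| ≤ C) (ξ : Lp E 2 μ) :
    MemLp (fun ω => a ω • ξ ω) 2 μ :=
  (Lp.memLp ξ).of_le_mul (ha.aestronglyMeasurable.smul (Lp.aestronglyMeasurable ξ))
    (ae_of_all _ fun ω => by
      rw [norm_smul]
      exact mul_le_mul_of_nonneg_right (hC ω) (norm_nonneg _))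

/-- Multiplication by a bounded measurable scalar function, as an operator on `L²`. -/
noncomputable def mulL2 (ha : StronglyMeasurable a) (hC : ∀ ω, |a ω| ≤ C) :
    Lp E 2 μ →L[ℝ] Lp E 2 μ :=
  LinearMap.mkContinuous
    { toFun := fun ξ => (memLp_smul_of_bounded ha hC ξ).toLp _
      map_add' := fun ξ η => by
        have hmem := memLp_smul_of_bounded (μ := μ) (E := E) ha hC
        ext1
        filter_upwards [(hmem (ξ + η)).coeFn_toLp, (hmem ξ).coeFn_toLp, (hmem η).coeFn_toLp,
          Lp.coeFn_add ξ η, Lp.coeFn_add ((hmem ξ).toLp _) ((hmem η).toLp _)] with ω h1 h2 h3 h4 h5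
        rw [h1, h5, Pi.add_apply, h2, h3, h4, Pi.add_apply, smul_add]
      map_smul' := fun c ξ => by
        have hmem := memLp_smul_of_bounded (μ := μ) (E := E) ha hC
        ext1
        filter_upwards [(hmem (c • ξ)).coeFn_toLp, (hmem ξ).coeFn_toLp,
          Lp.coeFn_smul c ξ, Lp.coeFn_smul c ((hmem ξ).toLp _)] with ω h1 h2 h3 h4
        rw [h1, RingHom.id_apply, h4, Pi.smul_apply, h2, h3, Pi.smul_apply, smul_comm] } C
    fun ξ => Lp.norm_le_mul_norm_of_ae_le_mul (by
      filter_upwards [(memLp_smul_of_bounded ha hC ξ).coeFn_toLp] with ω h1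
      change ‖((memLp_smul_of_bounded ha hC ξ).toLp _ : Ω → E) ω‖ ≤ _
      rw [h1, norm_smul]
      exact mul_le_mul_of_nonneg_right (hC ω) (norm_nonneg _))

lemma coeFn_mulL2 (ha : StronglyMeasurable a) (hC : ∀ ω, |a ω| ≤ C) (ξ : Lp E 2 μ) :
    (mulL2 ha hC ξ : Ω → E) =ᵐ[μ] fun ω => a ω • ξ ω :=
  (memLp_smul_of_bounded ha hC ξ).coeFn_toLp

end MulL2

/-! ### One period: losses of positions and positions without gain -/

section OnePeriod

variable {Ω E : Type*} {F m : MeasurableSpace Ω} {P : Measure Ω} [NormedAddCommGroup E]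
  [InnerProductSpace ℝ E] {hF : F ≤ m} {Y : Ω → E}

lemma aestronglyMeasurable_gain (hY : StronglyMeasurable[m] Y) (ξ : Lp E 2 (P.trim hF)) :
    AEStronglyMeasurable (fun ω => inner ℝ (ξ ω) (Y ω)) P :=
  ((Lp.stronglyMeasurable ξ).mono hF).aestronglyMeasurable.inner hY.aestronglyMeasurable

lemma abs_gain_le (hY1 : ∀ ω, ‖Y ω‖ ≤ 1) (x : E) (ω : Ω) : |inner ℝ x (Y ω)| ≤ ‖x‖ :=
  (abs_real_inner_le_norm _ _).trans (mul_le_of_le_one_right (norm_nonneg _) (hY1 ω))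

omit [InnerProductSpace ℝ E] in
lemma memLp_coe_of_trim (ξ : Lp E 2 (P.trim hF)) : MemLp (fun ω => ξ ω) 2 P :=
  memLp_of_memLp_trim hF (Lp.memLp ξ)

variable (hF Y P) in
/-- The positions `ξ` without gain or loss: `ξ · Y = 0` almost surely. -/
noncomputable def nullPositions : Submodule ℝ (Lp E 2 (P.trim hF)) where
  carrier := {ξ | ∀ᵐ ω ∂P, inner ℝ (ξ ω) (Y ω) = 0}
  add_mem' {ξ η} hξ hη := by
    rw [Set.mem_ofPred_eq] at *
    filter_upwards [ae_eq_of_ae_eq_trim (Lp.coeFn_add ξ η), hξ, hη] with ω h1 h2 h3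
    rw [h1, Pi.add_apply, inner_add_left, h2, h3, add_zero]
  zero_mem' := by
    rw [Set.mem_ofPred_eq]
    filter_upwards [ae_eq_of_ae_eq_trim (Lp.coeFn_zero E 2 (P.trim hF))] with ω h1
    rw [h1, Pi.zero_apply, inner_zero_left]
  smul_mem' c ξ hξ := by
    rw [Set.mem_ofPred_eq] at *
    filter_upwards [ae_eq_of_ae_eq_trim (Lp.coeFn_smul c ξ), hξ] with ω h1 h2
    rw [h1, Pi.smul_apply, real_inner_smul_left, h2, mul_zero]

lemma mem_nullPositions {ξ : Lp E 2 (P.trim hF)} :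
    ξ ∈ nullPositions P hF Y ↔ ∀ᵐ ω ∂P, inner ℝ (ξ ω) (Y ω) = 0 := Iff.rfl

variable [IsProbabilityMeasure P]

lemma integrable_gain (hY : StronglyMeasurable[m] Y) (hY1 : ∀ ω, ‖Y ω‖ ≤ 1)
    (ξ : Lp E 2 (P.trim hF)) : Integrable (fun ω => inner ℝ (ξ ω) (Y ω)) P :=
  ((memLp_coe_of_trim ξ).integrable one_le_two).norm.mono' (aestronglyMeasurable_gain hY ξ)
    (ae_of_all _ fun ω => abs_gain_le hY1 _ ω)

omit [InnerProductSpace ℝ E] in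
lemma integral_norm_coe_le (ξ : Lp E 2 (P.trim hF)) : ∫ ω, ‖ξ ω‖ ∂P ≤ ‖ξ‖ := by
  have h1 : ∫ ω, ‖ξ ω‖ ∂P = (eLpNorm (fun ω => ξ ω) 1 P).toReal := by
    rw [integral_norm_eq_lintegral_enorm (memLp_coe_of_trim ξ).aestronglyMeasurable,
      eLpNorm_one_eq_lintegral_enorm]
  rw [h1, Lp.norm_def, eLpNorm_trim hF (Lp.stronglyMeasurable ξ)]
  exact ENNReal.toReal_mono (memLp_coe_of_trim ξ).2.ne
    (eLpNorm_le_eLpNorm_of_exponent_le one_le_two (memLp_coe_of_trim ξ).aestronglyMeasurable)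

variable (hF Y P) in
/-- The expected shortfall `E[(ξ · Y)⁻]` of the one-period position `ξ`. -/
noncomputable def shortfall (ξ : Lp E 2 (P.trim hF)) : ℝ :=
  ∫ ω, max (-inner ℝ (ξ ω) (Y ω)) 0 ∂P

lemma integrable_shortfall (hY : StronglyMeasurable[m] Y) (hY1 : ∀ ω, ‖Y ω‖ ≤ 1)
    (ξ : Lp E 2 (P.trim hF)) : Integrable (fun ω => max (-inner ℝ (ξ ω) (Y ω)) 0) P :=
  (integrable_gain hY hY1 ξ).neg.pos_part

lemma shortfall_le_zero_iff (hY : StronglyMeasurable[m] Y) (hY1 : ∀ ω, ‖Y ω‖ ≤ 1)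
    (ξ : Lp E 2 (P.trim hF)) :
    shortfall P hF Y ξ ≤ 0 ↔ ∀ᵐ ω ∂P, 0 ≤ inner ℝ (ξ ω) (Y ω) := by
  have h0 : 0 ≤ fun ω => max (-inner ℝ (ξ ω) (Y ω)) 0 := fun ω => le_max_right _ _
  have h1 : 0 ≤ shortfall P hF Y ξ := integral_nonneg h0
  rw [h1.ge_iff_eq', shortfall, integral_eq_zero_iff_of_nonneg h0
    (integrable_shortfall hY hY1 ξ)]
  refine eventually_congr (ae_of_all _ fun ω => ?_)
  simp

lemma convexOn_shortfall (hY : StronglyMeasurable[m] Y) (hY1 : ∀ ω, ‖Y ω‖ ≤ 1) :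
    ConvexOn ℝ Set.univ (shortfall P hF Y) := by
  refine ⟨convex_univ, fun ξ _ η _ a b ha hb _ => ?_⟩
  have hi := integrable_shortfall hY hY1 (hF := hF) (P := P)
  rw [smul_eq_mul, smul_eq_mul, shortfall, shortfall, shortfall, ← integral_const_mul,
    ← integral_const_mul, ← integral_add ((hi ξ).const_mul a) ((hi η).const_mul b)]
  refine integral_mono_ae (hi _) (((hi ξ).const_mul a).add ((hi η).const_mul b)) ?_
  filter_upwards [ae_eq_of_ae_eq_trim (Lp.coeFn_add (a • ξ) (b • η)),
    ae_eq_of_ae_eq_trim (Lp.coeFn_smul a ξ), ae_eq_of_ae_eq_trim (Lp.coeFn_smul b η)]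
    with ω h1 h2 h3
  rw [h1, Pi.add_apply, h2, h3, Pi.smul_apply, Pi.smul_apply, inner_add_left, real_inner_smul_left,
    real_inner_smul_left]
  refine max_le ?_ (by positivity)
  have h4 := mul_le_mul_of_nonneg_left (le_max_left (-inner ℝ (ξ ω) (Y ω)) 0) ha
  have h5 := mul_le_mul_of_nonneg_left (le_max_left (-inner ℝ (η ω) (Y ω)) 0) hb
  linarith

lemma continuous_shortfall (hY : StronglyMeasurable[m] Y) (hY1 : ∀ ω, ‖Y ω‖ ≤ 1) :
    Continuous (shortfall P hF Y) := by
  have hi := integrable_shortfall hY hY1 (hF := hF) (P := P)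
  refine (LipschitzWith.of_le_add fun ξ η => ?_).continuous
  rw [dist_eq_norm]
  refine le_trans ?_ (add_le_add_right (integral_norm_coe_le (ξ - η)) _)
  have hn := ((memLp_coe_of_trim (ξ - η)).integrable one_le_two).norm
  rw [shortfall, shortfall, ← integral_add (hi η) hn]
  refine integral_mono_ae (hi _) ((hi η).add hn) ?_
  filter_upwards [ae_eq_of_ae_eq_trim (Lp.coeFn_sub ξ η)] with ω h1
  rw [h1, Pi.sub_apply]
  have h2 := abs_gain_le hY1 (ξ ω - η ω) ω
  rw [inner_sub_left] at h2
  have h3 := abs_le.1 h2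
  have h4 := le_max_left (-inner ℝ (η ω) (Y ω)) 0
  have h5 := le_max_right (-inner ℝ (η ω) (Y ω)) 0
  exact max_le (by linarith [h3.1]) (by positivity)

lemma isClosed_nullPositions (hY : StronglyMeasurable[m] Y) (hY1 : ∀ ω, ‖Y ω‖ ≤ 1) :
    IsClosed (nullPositions P hF Y : Set (Lp E 2 (P.trim hF))) := by
  have hc := continuous_shortfall hY hY1 (hF := hF) (P := P)
  have : (nullPositions P hF Y : Set (Lp E 2 (P.trim hF))) =
      {ξ | shortfall P hF Y ξ ≤ 0} ∩ {ξ | shortfall P hF Y (-ξ) ≤ 0} := by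
    ext ξ
    rw [Set.mem_inter_iff, Set.mem_ofPred_eq, Set.mem_ofPred_eq, shortfall_le_zero_iff hY hY1,
      shortfall_le_zero_iff hY hY1, ← eventually_and, SetLike.mem_coe, mem_nullPositions]
    refine eventually_congr ?_
    filter_upwards [ae_eq_of_ae_eq_trim (Lp.coeFn_neg ξ)] with ω h1
    rw [h1, Pi.neg_apply, inner_neg_left, Left.nonneg_neg_iff, and_comm, le_antisymm_iff]
  rw [this]
  exact (isClosed_le hc continuous_const).inter
    (isClosed_le (hc.comp continuous_neg) continuous_const)

/-- Every position can be replaced by one orthogonal to the null positions without changing its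
gain. -/
lemma exists_orthogonal_gain_eq [CompleteSpace E] (hY : StronglyMeasurable[m] Y)
    (hY1 : ∀ ω, ‖Y ω‖ ≤ 1)
    (ξ : Lp E 2 (P.trim hF)) : ∃ ξ' ∈ (nullPositions P hF Y)ᗮ,
      (fun ω => inner ℝ (ξ' ω) (Y ω)) =ᵐ[P] fun ω => inner ℝ (ξ ω) (Y ω) := by
  obtain ⟨ν, hν, ξ', hξ', h⟩ :=
    exists_eq_add_of_isClosed (isClosed_nullPositions (P := P) (hF := hF) hY hY1) ξ
  refine ⟨ξ', hξ', ?_⟩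
  rw [mem_nullPositions] at hν
  filter_upwards [ae_eq_of_ae_eq_trim (Lp.coeFn_add ν ξ'), hν] with ω h1 h2
  rw [h, h1, Pi.add_apply, inner_add_left, h2, zero_add]

omit [IsProbabilityMeasure P] in
/-- The orthogonal complement of the null positions is stable under bounded `F`-measurable
scalars. -/
lemma mulL2_mem_orthogonal {a : Ω → ℝ} (ha : StronglyMeasurable[F] a) {C : ℝ}
    (hC : ∀ ω, |a ω| ≤ C) {ξ : Lp E 2 (P.trim hF)} (hξ : ξ ∈ (nullPositions P hF Y)ᗮ) :
    mulL2 ha hC ξ ∈ (nullPositions P hF Y)ᗮ := by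
  intro η hη
  have h1 : mulL2 ha hC η ∈ nullPositions P hF Y := by
    rw [mem_nullPositions] at *
    filter_upwards [ae_eq_of_ae_eq_trim (coeFn_mulL2 ha hC η), hη] with ω h2 h3
    rw [h2, real_inner_smul_left, h3, mul_zero]
  rw [← hξ _ h1, L2.inner_def, L2.inner_def]
  refine integral_congr_ae ?_
  filter_upwards [coeFn_mulL2 ha hC η, coeFn_mulL2 ha hC ξ] with ω h2 h3
  rw [h2, h3, real_inner_smul_left, real_inner_smul_right]

end OnePeriod

/-! ### One period: minimising the exponential disutility -/

section OnePeriod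

variable {Ω E : Type*} {F m : MeasurableSpace Ω} {P : Measure Ω} [IsProbabilityMeasure P]
  [NormedAddCommGroup E] [InnerProductSpace ℝ E] {hF : F ≤ m} {Y : Ω → E}

/-- Along a sequence of positions `ξ k` minimising `E[exp (-ξ · Y)]`, the
functions `exp (-ξ k · Y / 2)` form a Cauchy sequence in `L²`, since the scalar product of two of
them is the value at the midpoint. The square of the limit inherits the optimality, although the
positions themselves need not converge. -/
lemma exists_exponential_minimiser [CompleteSpace E] (hY : StronglyMeasurable[m] Y)
    (hY1 : ∀ ω, ‖Y ω‖ ≤ 1) :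
    ∃ (ξ : ℕ → Lp E 2 (P.trim hF)) (u : Lp ℝ 2 P),
      (∀ k, ξ k ∈ (nullPositions P hF Y)ᗮ) ∧
      (∀ᵐ ω ∂P, Tendsto (fun k => Real.exp (-inner ℝ (ξ k ω) (Y ω) / 2)) atTop (𝓝 (u ω))) ∧
      ∀ η : Ω → E, StronglyMeasurable[F] η → (∀ ω, ‖η ω‖ ≤ 1) →
        ∫ ω, u ω ^ 2 ∂P ≤ ∫ ω, Real.exp (-inner ℝ (η ω) (Y ω)) * u ω ^ 2 ∂P := by
  let S : Set ℝ := {c | ∃ ξ : Lp E 2 (P.trim hF),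
    Integrable (fun ω => Real.exp (-inner ℝ (ξ ω) (Y ω))) P ∧
      ∫ ω, Real.exp (-inner ℝ (ξ ω) (Y ω)) ∂P = c}
  have hSbdd : BddBelow S :=
    ⟨0, by rintro _ ⟨ξ, -, rfl⟩; exact integral_nonneg fun ω => (Real.exp_pos _).le⟩
  have hSne : S.Nonempty := by
    refine ⟨_, 0, (integrable_const (1 : ℝ)).congr ?_, rfl⟩
    filter_upwards [ae_eq_of_ae_eq_trim (Lp.coeFn_zero E 2 (P.trim hF))] with ω h1
    rw [h1, Pi.zero_apply, inner_zero_left, neg_zero, Real.exp_zero]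
  have hle : ∀ ξ : Lp E 2 (P.trim hF), ∀ g : Ω → ℝ, Integrable g P →
      (fun ω => Real.exp (-inner ℝ (ξ ω) (Y ω))) =ᵐ[P] g → sInf S ≤ ∫ ω, g ω ∂P :=
    fun ξ g hg h => csInf_le hSbdd ⟨ξ, hg.congr h.symm, integral_congr_ae h⟩
  obtain ⟨c, -, hc, hcS⟩ := exists_seq_tendsto_sInf hSne hSbdd
  choose ξ₀ hint₀ hval₀ using hcS
  choose ξ hξ hgain using fun k => exists_orthogonal_gain_eq hY hY1 (ξ₀ k)
  have hexp : ∀ k, (fun ω => Real.exp (-inner ℝ (ξ₀ k ω) (Y ω))) =ᵐ[P]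
      fun ω => Real.exp (-inner ℝ (ξ k ω) (Y ω) / 2) ^ 2 := fun k => by
    filter_upwards [hgain k] with ω h1
    rw [h1, ← Real.exp_nat_mul]
    congr 1
    push_cast
    ring
  have hmem : ∀ k, MemLp (fun ω => Real.exp (-inner ℝ (ξ k ω) (Y ω) / 2)) 2 P := fun k => by
    rw [memLp_two_iff_integrable_sq]
    · exact (hint₀ k).congr (hexp k)
    · exact (by fun_prop : Continuous fun x : ℝ => Real.exp (-x / 2)).comp_aestronglyMeasurable
        (aestronglyMeasurable_gain hY (ξ k))
  let U : ℕ → Lp ℝ 2 P := fun k => (hmem k).toLp _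
  have hU : ∀ k, (U k : Ω → ℝ) =ᵐ[P] fun ω => Real.exp (-inner ℝ (ξ k ω) (Y ω) / 2) :=
    fun k => (hmem k).coeFn_toLp
  have hnorm : ∀ k, ‖U k‖ ^ 2 = c k := fun k => by
    rw [← real_inner_self_eq_norm_sq, L2.inner_def, ← hval₀ k]
    refine integral_congr_ae ?_
    filter_upwards [hU k, hexp k] with ω h1 h2
    rw [h1, h2, real_inner_self_eq_norm_sq, Real.norm_of_nonneg (Real.exp_pos _).le]
  -- the scalar product of `U j` and `U k` is the disutility of the midpoint of `ξ j` and `ξ k`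
  have hinner : ∀ j k, sInf S ≤ inner ℝ (U j) (U k) := fun j k => by
    rw [L2.inner_def]
    refine hle ((1 / 2 : ℝ) • (ξ j + ξ k)) _ (L2.integrable_inner _ _) ?_
    filter_upwards [hU j, hU k, ae_eq_of_ae_eq_trim (Lp.coeFn_add (ξ j) (ξ k)),
      ae_eq_of_ae_eq_trim (Lp.coeFn_smul (1 / 2 : ℝ) (ξ j + ξ k))] with ω h1 h2 h3 h4
    rw [h4, Pi.smul_apply, h3, Pi.add_apply, h1, h2, real_inner_smul_left, inner_add_left]
    rw [RCLike.inner_apply, conj_trivial, ← Real.exp_add]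
    congr 1
    ring
  have hcauchy : CauchySeq U := by
    rw [Metric.cauchySeq_iff']
    intro ε hε
    obtain ⟨N, hN⟩ := eventually_atTop.1 (hc.eventually_lt_const
      (show sInf S < sInf S + ε ^ 2 / 2 by linarith [pow_pos hε 2]))
    refine ⟨N, fun n hn => ?_⟩
    rw [dist_eq_norm]
    refine lt_of_pow_lt_pow_left₀ 2 hε.le ?_
    have h1 := hN n hn
    have h2 := hN N le_rfl
    have h3 := hinner n N
    rw [norm_sub_sq_real, hnorm, hnorm]
    linarith
  obtain ⟨u, hu⟩ := cauchySeq_tendsto_of_complete hcauchy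
  obtain ⟨ns, hns, hlim⟩ := (tendstoInMeasure_of_tendsto_Lp hu).exists_seq_tendsto_ae
  refine ⟨fun k => ξ (ns k), u, fun k => hξ _, ?_, fun η hη hη1 => ?_⟩
  · filter_upwards [hlim, ae_all_iff.2 hU] with ω h1 h2
    simpa only [h2] using h1
  · have hg : ∀ ω, |Real.exp (-inner ℝ (η ω) (Y ω))| ≤ Real.exp 1 := fun ω => by
      rw [Real.abs_exp, Real.exp_le_exp]
      exact (neg_le_abs _).trans ((abs_gain_le hY1 _ ω).trans (hη1 ω))
    have hgm : StronglyMeasurable[m] fun ω => Real.exp (-inner ℝ (η ω) (Y ω)) :=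
      Real.continuous_exp.comp_stronglyMeasurable ((hη.mono hF).inner hY).neg
    have h1 : ∫ ω, u ω ^ 2 ∂P = sInf S := by
      have h2 : ∫ ω, u ω ^ 2 ∂P = ‖u‖ ^ 2 := by
        rw [← real_inner_self_eq_norm_sq, L2.inner_def]
        refine integral_congr_ae (ae_of_all _ fun ω => ?_)
        change u ω ^ 2 = inner ℝ (u ω) (u ω)
        rw [real_inner_self_eq_norm_sq, Real.norm_eq_abs, sq_abs]
      rw [h2]
      exact tendsto_nhds_unique (hu.norm.pow 2) (by simpa only [hnorm] using hc)
    have h2 : ∫ ω, Real.exp (-inner ℝ (η ω) (Y ω)) * u ω ^ 2 ∂P =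
        inner ℝ u (mulL2 hgm hg u) := by
      rw [L2.inner_def]
      refine integral_congr_ae ?_
      filter_upwards [coeFn_mulL2 hgm hg u] with ω h3
      rw [h3, real_inner_smul_right, real_inner_self_eq_norm_sq, Real.norm_eq_abs, sq_abs]
    rw [h1, h2]
    refine ge_of_tendsto' (hu.inner (((mulL2 hgm hg).continuous.tendsto u).comp hu)) fun k => ?_
    have hηL : MemLp η 2 (P.trim hF) :=
      MemLp.of_bound hη.aestronglyMeasurable 1 (ae_of_all _ hη1)
    rw [L2.inner_def]
    refine hle (ξ k + hηL.toLp η) _ (L2.integrable_inner _ _) ?_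
    filter_upwards [hU k, ae_eq_of_ae_eq_trim (Lp.coeFn_add (ξ k) (hηL.toLp η)),
      ae_eq_of_ae_eq_trim hηL.coeFn_toLp, coeFn_mulL2 hgm hg (U k)] with ω h3 h4 h5 h6
    rw [Function.comp_apply, h6, h3, h4, Pi.add_apply, h5, inner_add_left,
      real_inner_smul_right, real_inner_self_eq_norm_sq, Real.norm_eq_abs, sq_abs,
      ← Real.exp_nat_mul, ← Real.exp_add]
    congr 1
    push_cast
    ring

omit [IsProbabilityMeasure P] in
/-- First-order condition for the exponential minimiser. -/
lemma integral_gain_eq_zero_of_minimal (hY : StronglyMeasurable[m] Y) (hY1 : ∀ ω, ‖Y ω‖ ≤ 1)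
    (hF : F ≤ m) {u : Lp ℝ 2 P}
    (hu : ∀ η : Ω → E, StronglyMeasurable[F] η → (∀ ω, ‖η ω‖ ≤ 1) →
        ∫ ω, u ω ^ 2 ∂P ≤ ∫ ω, Real.exp (-inner ℝ (η ω) (Y ω)) * u ω ^ 2 ∂P)
    {η : Ω → E} (hη : StronglyMeasurable[F] η) (hη1 : ∀ ω, ‖η ω‖ ≤ 1) :
    ∫ ω, u ω ^ 2 * inner ℝ (η ω) (Y ω) ∂P = 0 := by
  have hg1 : ∀ ω, |inner ℝ (η ω) (Y ω)| ≤ 1 := fun ω => (abs_gain_le hY1 _ ω).trans (hη1 ω)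
  have hgm : StronglyMeasurable[m] fun ω => inner ℝ (η ω) (Y ω) := (hη.mono hF).inner hY
  have hi : Integrable (fun ω => u ω ^ 2) P := (Lp.memLp u).integrable_sq
  have hi1 : Integrable (fun ω => u ω ^ 2 * inner ℝ (η ω) (Y ω)) P :=
    hi.mul_bdd (c := 1) hgm.aestronglyMeasurable (ae_of_all _ hg1)
  have hi2 : Integrable (fun ω => u ω ^ 2 * inner ℝ (η ω) (Y ω) ^ 2) P := by
    refine hi.mul_bdd (c := 1) (hgm.pow 2).aestronglyMeasurable (ae_of_all _ fun ω => ?_)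
    rw [Real.norm_eq_abs, abs_pow]
    exact pow_le_one₀ (abs_nonneg _) (hg1 ω)
  set a := ∫ ω, u ω ^ 2 * inner ℝ (η ω) (Y ω) ∂P with ha
  set b := ∫ ω, u ω ^ 2 * inner ℝ (η ω) (Y ω) ^ 2 ∂P with hb
  have hb0 : 0 ≤ b := integral_nonneg fun ω => by positivity
  have key : ∀ t : ℝ, |t| ≤ 1 → t * a ≤ t ^ 2 * b := by
    intro t ht
    have h1 := hu (fun ω => t • η ω) (hη.const_smul t) fun ω => by
      rw [norm_smul]
      exact mul_le_one₀ ht (norm_nonneg _) (hη1 ω)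
    have hsub : Integrable (fun ω => u ω ^ 2 - t * (u ω ^ 2 * inner ℝ (η ω) (Y ω))) P :=
      hi.sub (hi1.const_mul t)
    have h2 : ∫ ω, Real.exp (-inner ℝ (t • η ω) (Y ω)) * u ω ^ 2 ∂P ≤
        ∫ ω, (u ω ^ 2 - t * (u ω ^ 2 * inner ℝ (η ω) (Y ω)) +
          t ^ 2 * (u ω ^ 2 * inner ℝ (η ω) (Y ω) ^ 2)) ∂P := by
      refine integral_mono_of_nonneg (ae_of_all _ fun ω => ?_)
        (hsub.add (hi2.const_mul (t ^ 2))) (ae_of_all _ fun ω => ?_)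
      · change 0 ≤ Real.exp (-inner ℝ (t • η ω) (Y ω)) * u ω ^ 2
        positivity
      · have h3 : |-inner ℝ (t • η ω) (Y ω)| ≤ 1 := by
          rw [abs_neg, real_inner_smul_left, abs_mul]
          exact mul_le_one₀ ht (abs_nonneg _) (hg1 ω)
        have h4 := (le_abs_self _).trans (Real.abs_exp_sub_one_sub_id_le h3)
        dsimp only
        rw [real_inner_smul_left] at h4 ⊢
        have h5 := mul_le_mul_of_nonneg_right h4 (sq_nonneg (u ω))
        linarith
    rw [integral_add hsub (hi2.const_mul (t ^ 2)),
      integral_sub hi (hi1.const_mul t), integral_const_mul, integral_const_mul] at h2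
    linarith
  -- a small multiple of `a`, of size at most `1`, contradicts `key` unless `a = 0`
  by_contra hne
  have hK : 0 < 1 + b + |a| := by positivity
  have h1 := key (a / (1 + b + |a|)) (by
    rw [abs_div, abs_of_pos hK, div_le_one hK]
    linarith)
  have h2 : 0 < a ^ 2 := by positivity
  rw [div_pow, div_mul_eq_mul_div, div_mul_eq_mul_div, div_le_div_iff₀ hK (by positivity)] at h1
  have h3 : a ^ 2 * (1 + b + |a|) * (1 + |a|) ≤ 0 := by nlinarith
  have h4 : 0 < a ^ 2 * (1 + b + |a|) * (1 + |a|) := by positivity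
  linarith

end OnePeriod

/-! ### One period: positivity of the minimiser -/

section OnePeriod

variable {Ω E : Type*} {F m : MeasurableSpace Ω} {P : Measure Ω} [IsProbabilityMeasure P]
  [NormedAddCommGroup E] [InnerProductSpace ℝ E] {hF : F ≤ m} {Y : Ω → E}

/-- The set on which the positions `ξ k` diverge. -/
def divergenceSet (ξ : ℕ → Ω → E) : Set Ω := {ω | Tendsto (fun k => ‖ξ k ω‖) atTop atTop}

/-- The scalar `1 / (1 + ‖ξ k‖)` on the divergence set, and `0` outside of it. The positions
multiplied by it are bounded by `1`, and their norms tend to `1` on the divergence set. -/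
noncomputable def normaliser (ξ : ℕ → Ω → E) (k : ℕ) (ω : Ω) : ℝ :=
  (divergenceSet ξ).indicator (fun ω => (1 + ‖ξ k ω‖)⁻¹) ω

omit [InnerProductSpace ℝ E] in
lemma measurableSet_divergenceSet {ξ : ℕ → Ω → E} (hξ : ∀ k, StronglyMeasurable[F] (ξ k)) :
    MeasurableSet[F] (divergenceSet ξ) :=
  measurableSet_tendsto _ fun k => (hξ k).norm.measurable

omit [InnerProductSpace ℝ E] in
lemma stronglyMeasurable_normaliser {ξ : ℕ → Ω → E} (hξ : ∀ k, StronglyMeasurable[F] (ξ k))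
    (k : ℕ) : StronglyMeasurable[F] (normaliser ξ k) :=
  ((measurable_const.add (hξ k).norm.measurable).inv.indicator
    (measurableSet_divergenceSet hξ)).stronglyMeasurable

omit [InnerProductSpace ℝ E] in
lemma normaliser_nonneg (ξ : ℕ → Ω → E) (k : ℕ) (ω : Ω) : 0 ≤ normaliser ξ k ω :=
  Set.indicator_nonneg (fun _ _ => by positivity) ω

omit [InnerProductSpace ℝ E] in
lemma normaliser_le (ξ : ℕ → Ω → E) (k : ℕ) (ω : Ω) : normaliser ξ k ω ≤ (1 + ‖ξ k ω‖)⁻¹ :=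
  Set.indicator_le_self' (fun _ _ => by positivity) ω

omit [InnerProductSpace ℝ E] in
lemma normaliser_mul_norm_le (ξ : ℕ → Ω → E) (k : ℕ) (ω : Ω) :
    normaliser ξ k ω * ‖ξ k ω‖ ≤ 1 := by
  refine (mul_le_mul_of_nonneg_right (normaliser_le ξ k ω) (norm_nonneg _)).trans ?_
  rw [inv_mul_le_iff₀ (by positivity)]
  linarith

/-- If the disutilities of the positions `ξ k`, orthogonal to the null positions, converge almost
surely, then their normalisations on the divergence set converge weakly to `0`, because each weak
limit would be an arbitrage. -/
lemma eventually_integral_inner_lt (hY : StronglyMeasurable[m] Y) (hY1 : ∀ ω, ‖Y ω‖ ≤ 1)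
    [CompleteSpace E]
    (hNA : ∀ ξ : Ω → E, StronglyMeasurable[F] ξ → (∀ᵐ ω ∂P, 0 ≤ inner ℝ (ξ ω) (Y ω)) →
      ∀ᵐ ω ∂P, inner ℝ (ξ ω) (Y ω) = 0)
    {ξ : ℕ → Lp E 2 (P.trim hF)} {u : Ω → ℝ} (hξ : ∀ k, ξ k ∈ (nullPositions P hF Y)ᗮ)
    (hu : ∀ᵐ ω ∂P, Tendsto (fun k => Real.exp (-inner ℝ (ξ k ω) (Y ω) / 2)) atTop (𝓝 (u ω)))
    {b : ℕ → Ω → ℝ} (hb : ∀ k, StronglyMeasurable[F] (b k)) (hb0 : ∀ k ω, 0 ≤ b k ω)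
    (hb2 : ∀ k ω, b k ω ≤ 2 * normaliser (fun k ω => ξ k ω) k ω) (v : E) {δ : ℝ} (hδ : 0 < δ) :
    ∀ᶠ k in atTop, ∫ ω, b k ω * inner ℝ v (ξ k ω) ∂P < δ := by
  have hN : ∀ η : Lp E 2 (P.trim hF), shortfall P hF Y η ≤ 0 → η ∈ nullPositions P hF Y :=
    fun η hη => mem_nullPositions.2
      (hNA _ (Lp.stronglyMeasurable η) ((shortfall_le_zero_iff hY hY1 η).1 hη))
  have hbC : ∀ k ω, |b k ω| ≤ 2 := fun k ω => by
    rw [abs_of_nonneg (hb0 k ω)]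
    refine (hb2 k ω).trans (mul_le_of_le_one_right two_pos.le ((normaliser_le _ k ω).trans ?_))
    exact inv_le_one_of_one_le₀ (by simp)
  have hbn : ∀ k ω, b k ω * ‖ξ k ω‖ ≤ 2 := fun k ω => by
    have h1 := normaliser_mul_norm_le (fun k ω => ξ k ω) k ω
    have h2 := mul_le_mul_of_nonneg_right (hb2 k ω) (norm_nonneg (ξ k ω))
    linarith
  have hvL : MemLp (fun _ : Ω => v) 2 (P.trim hF) := memLp_const v
  have hconv := convexOn_shortfall (P := P) (hF := hF) hY hY1
  have hcont := continuous_shortfall (P := P) (hF := hF) hY hY1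
  obtain ⟨ε, hε, hW⟩ := exists_forall_inner_lt_of_convexOn (H := Lp E 2 (P.trim hF))
    (φ := shortfall P hF Y) (N := nullPositions P hF Y) hconv hcont hN (hvL.toLp _) 2 hδ
  let ζ : ℕ → Lp E 2 (P.trim hF) := fun k => mulL2 (hb k) (hbC k) (ξ k)
  have hζ : ∀ k, (ζ k : Ω → E) =ᵐ[P.trim hF] fun ω => b k ω • ξ k ω :=
    fun k => coeFn_mulL2 (hb k) (hbC k) (ξ k)
  -- convergence of the disutilities bounds the losses of `ξ k` pointwise, so the scaled losses vanish
  have hlim : Tendsto (fun k => shortfall P hF Y (ζ k)) atTop (𝓝 0) := by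
    have h0 : (0 : ℝ) = ∫ _ω : Ω, (0 : ℝ) ∂P := by simp
    rw [h0]
    refine tendsto_integral_of_dominated_convergence (fun _ => 2)
      (fun k => (integrable_shortfall hY hY1 _).aestronglyMeasurable) (integrable_const _)
      (fun k => ?_) ?_
    · filter_upwards [ae_eq_of_ae_eq_trim (hζ k)] with ω h1
      rw [Real.norm_of_nonneg (le_max_right _ _), h1]
      refine max_le ((neg_le_abs _).trans ((abs_gain_le hY1 _ ω).trans ?_)) two_pos.le
      rw [norm_smul, Real.norm_of_nonneg (hb0 k ω)]
      exact hbn k ω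
    · filter_upwards [hu, ae_all_iff.2 fun k => ae_eq_of_ae_eq_trim (hζ k)] with ω h1 h2
      by_cases hω : ω ∈ divergenceSet fun k ω => ξ k ω
      · have h3 : Tendsto (fun k => 2 * (1 + ‖ξ k ω‖)⁻¹ *
            (2 * Real.exp (-inner ℝ (ξ k ω) (Y ω) / 2))) atTop (𝓝 (2 * 0 * (2 * u ω))) := by
          refine Tendsto.mul (Tendsto.const_mul 2 (tendsto_inv_atTop_zero.comp ?_))
            (h1.const_mul 2)
          exact tendsto_atTop_add_const_left _ 1 hω
        rw [mul_zero, zero_mul] at h3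
        refine squeeze_zero (fun k => le_max_right _ _) (fun k => ?_) h3
        rw [h2 k, real_inner_smul_left]
        refine max_le ?_ (by positivity)
        have h4 := Real.add_one_le_exp (-inner ℝ (ξ k ω) (Y ω) / 2)
        have h5 := Real.exp_pos (-inner ℝ (ξ k ω) (Y ω) / 2)
        calc -(b k ω * inner ℝ (ξ k ω) (Y ω))
            = b k ω * (-inner ℝ (ξ k ω) (Y ω)) := by ring
          _ ≤ b k ω * (2 * Real.exp (-inner ℝ (ξ k ω) (Y ω) / 2)) :=
              mul_le_mul_of_nonneg_left (by linarith) (hb0 k ω)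
          _ ≤ _ := by
              refine mul_le_mul_of_nonneg_right ((hb2 k ω).trans ?_) (by positivity)
              exact mul_le_mul_of_nonneg_left (normaliser_le _ k ω) two_pos.le
      · have h3 : ∀ k, b k ω = 0 := fun k => le_antisymm
          ((hb2 k ω).trans (by rw [normaliser, Set.indicator_of_notMem hω, mul_zero])) (hb0 k ω)
        simp [h2, h3]
  filter_upwards [hlim.eventually_le_const hε] with k hk
  have h1 := hW (ζ k) (mulL2_mem_orthogonal (hb k) (hbC k) (hξ k)) ?_ hk
  · rw [L2.inner_def] at h1
    rw [integral_trim hF]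
    · refine lt_of_eq_of_lt (integral_congr_ae ?_) h1
      filter_upwards [hζ k, hvL.coeFn_toLp] with ω h2 h3
      rw [h2, h3, real_inner_smul_right]
    · exact (hb k).mul (stronglyMeasurable_const.inner (Lp.stronglyMeasurable _))
  · refine (Lp.norm_le_of_ae_bound (C := 2) two_pos.le ?_).trans (by
      simp [measureUnivNNReal, trim_measurableSet_eq hF MeasurableSet.univ])
    filter_upwards [hζ k] with ω h2
    rw [h2, norm_smul, Real.norm_of_nonneg (hb0 k ω)]
    exact hbn k ω

/-- Without arbitrage the limiting disutility does not vanish: the normalised positions have norm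
tending to `1` on the divergence set and coordinates tending to `0` in mean square. -/
lemma ae_ne_zero_of_tendsto_exp {ι : Type*} [Fintype ι] (e : OrthonormalBasis ι ℝ E)
    (hY : StronglyMeasurable[m] Y) (hY1 : ∀ ω, ‖Y ω‖ ≤ 1)
    [CompleteSpace E]
    (hNA : ∀ ξ : Ω → E, StronglyMeasurable[F] ξ → (∀ᵐ ω ∂P, 0 ≤ inner ℝ (ξ ω) (Y ω)) →
      ∀ᵐ ω ∂P, inner ℝ (ξ ω) (Y ω) = 0)
    {ξ : ℕ → Lp E 2 (P.trim hF)} {u : Ω → ℝ} (hξ : ∀ k, ξ k ∈ (nullPositions P hF Y)ᗮ)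
    (hu : ∀ᵐ ω ∂P, Tendsto (fun k => Real.exp (-inner ℝ (ξ k ω) (Y ω) / 2)) atTop (𝓝 (u ω))) :
    ∀ᵐ ω ∂P, u ω ≠ 0 := by
  set a : ℕ → Ω → ℝ := normaliser fun k ω => ξ k ω with ha_def
  set B : Set Ω := divergenceSet fun k ω => ξ k ω with hB_def
  have hξm : ∀ k, StronglyMeasurable[F] fun ω => ξ k ω := fun k => Lp.stronglyMeasurable _
  have hBm : MeasurableSet[m] B := hF _ (measurableSet_divergenceSet hξm)
  have ham : ∀ k, StronglyMeasurable[F] (a k) := stronglyMeasurable_normaliser hξm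
  have ha0 : ∀ k ω, 0 ≤ a k ω := normaliser_nonneg _
  have han : ∀ k ω, a k ω * ‖ξ k ω‖ ≤ 1 := normaliser_mul_norm_le _
  let x : ι → ℕ → Ω → ℝ := fun i k ω => a k ω * inner ℝ (e i) (ξ k ω)
  have hxm : ∀ i k, StronglyMeasurable[F] (x i k) := fun i k =>
    (ham k).mul (stronglyMeasurable_const.inner (hξm k))
  have hx1 : ∀ i k ω, |x i k ω| ≤ 1 := fun i k ω => by
    rw [abs_mul, abs_of_nonneg (ha0 k ω)]
    refine (mul_le_mul_of_nonneg_left ?_ (ha0 k ω)).trans (han k ω)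
    simpa using abs_real_inner_le_norm (e i) (ξ k ω)
  have hxi : ∀ i k, Integrable (x i k) P := fun i k =>
    Integrable.of_bound ((hxm i k).mono hF).aestronglyMeasurable 1 (ae_of_all _ (hx1 i k))
  have hxi2 : ∀ i k, Integrable (fun ω => x i k ω ^ 2) P := fun i k =>
    Integrable.of_bound (((hxm i k).pow 2).mono hF).aestronglyMeasurable 1 (ae_of_all _ fun ω => by
      rw [Real.norm_eq_abs, abs_pow]
      exact pow_le_one₀ (abs_nonneg _) (hx1 i k ω))
  -- `x i k ^ 2 = (1 + x i k) * x i k - x i k`, with nonnegative scalars `a k * (1 + x i k)`, `a k`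
  have hsq : ∀ i, ∀ δ > 0, ∀ᶠ k in atTop, ∫ ω, x i k ω ^ 2 ∂P ≤ δ := by
    intro i δ hδ
    filter_upwards [
      eventually_integral_inner_lt hY hY1 hNA hξ hu (b := fun k ω => a k ω * (1 + x i k ω))
        (fun k => (ham k).mul (stronglyMeasurable_const.add (hxm i k)))
        (fun k ω => mul_nonneg (ha0 k ω) (by linarith [(abs_le.1 (hx1 i k ω)).1]))
        (fun k ω => by
          rw [mul_comm]
          exact mul_le_mul_of_nonneg_right (by linarith [(abs_le.1 (hx1 i k ω)).2]) (ha0 k ω))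
        (e i) (half_pos hδ),
      eventually_integral_inner_lt hY hY1 hNA hξ hu (b := a) ham ha0
        (fun k ω => by change a k ω ≤ 2 * a k ω; linarith [ha0 k ω]) (-e i) (half_pos hδ)]
      with k h1 h2
    have h3 : ∫ ω, a k ω * (1 + x i k ω) * inner ℝ (e i) (ξ k ω) ∂P =
        ∫ ω, x i k ω ∂P + ∫ ω, x i k ω ^ 2 ∂P := by
      rw [← integral_add (hxi i k) (hxi2 i k)]
      congr 1 with ω
      simp only [x]
      ring
    have h4 : ∫ ω, a k ω * inner ℝ (-e i) (ξ k ω) ∂P = -∫ ω, x i k ω ∂P := by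
      rw [← integral_neg]
      congr 1 with ω
      simp only [x, inner_neg_left]
      ring
    rw [h3] at h1
    rw [h4] at h2
    linarith
  have hnorm : ∀ k ω, ∑ i, x i k ω ^ 2 = (a k ω * ‖ξ k ω‖) ^ 2 := fun k ω => by
    simp only [x, mul_pow]
    rw [← Finset.mul_sum, e.sum_sq_inner_right]
  have hlim : Tendsto (fun k => ∫ ω, ∑ i, x i k ω ^ 2 ∂P) atTop (𝓝 (P.real B)) := by
    have h0 : P.real B = ∫ ω, B.indicator (fun _ => (1 : ℝ)) ω ∂P := by
      rw [integral_indicator hBm]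
      simp
    rw [h0]
    refine tendsto_integral_of_dominated_convergence (fun _ => 1)
      (fun k => (integrable_finsetSum _ fun i _ => hxi2 i k).aestronglyMeasurable)
      (integrable_const _) (fun k => ae_of_all _ fun ω => ?_) (ae_of_all _ fun ω => ?_)
    · rw [hnorm, Real.norm_of_nonneg (sq_nonneg _)]
      exact pow_le_one₀ (mul_nonneg (ha0 k ω) (norm_nonneg _)) (han k ω)
    · simp_rw [hnorm]
      by_cases hω : ω ∈ B
      · have h1 : Tendsto (fun k => (1 - (1 + ‖ξ k ω‖)⁻¹) ^ 2) atTop (𝓝 ((1 - 0) ^ 2)) := by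
          refine (Tendsto.const_sub 1 (tendsto_inv_atTop_zero.comp ?_)).pow 2
          exact tendsto_atTop_add_const_left _ 1 hω
        rw [Set.indicator_of_mem hω]
        norm_num at h1
        refine h1.congr fun k => ?_
        rw [ha_def, normaliser, Set.indicator_of_mem hω]
        have h2 : 1 + ‖ξ k ω‖ ≠ 0 := by positivity
        field_simp
        ring
      · rw [Set.indicator_of_notMem hω]
        refine tendsto_const_nhds.congr fun k => ?_
        rw [ha_def, normaliser, Set.indicator_of_notMem hω]
        simp
  have hB0 : P B = 0 := by
    rw [← measureReal_eq_zero_iff]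
    refine le_antisymm (le_of_forall_pos_le_add fun δ hδ => ?_) measureReal_nonneg
    rw [zero_add]
    have hc : (0 : ℝ) < Fintype.card ι + 1 := by positivity
    refine le_of_tendsto hlim ?_
    filter_upwards [eventually_all.2 fun i => hsq i (δ / (Fintype.card ι + 1)) (by positivity)]
      with k hk
    rw [integral_finsetSum _ fun i _ => hxi2 i k]
    refine (Finset.sum_le_sum fun i _ => hk i).trans ?_
    rw [Finset.sum_const, Finset.card_univ, nsmul_eq_mul, mul_div_assoc', div_le_iff₀ hc]
    nlinarith
  -- where `u = 0`, the gains and hence the positions tend to infinity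
  filter_upwards [hu, measure_eq_zero_iff_ae_notMem.1 hB0] with ω h1 h2 h3
  refine h2 ?_
  rw [h3] at h1
  have h4 := Real.tendsto_exp_comp_nhds_zero.1 h1
  have h5 := (tendsto_neg_atBot_atTop.comp h4).const_mul_atTop (two_pos (α := ℝ))
  refine tendsto_atTop_mono (fun k => ?_) h5
  have h6 := (le_abs_self _).trans (abs_gain_le hY1 (ξ k ω) ω)
  simp only [Function.comp_apply]
  linarith

/-- The one-period theorem for bounded increments: without arbitrage there is a positive integrable
density under which the increment is orthogonal to all positions. -/
lemma exists_pos_integrable_integral_gain_eq_zero {ι : Type*} [Fintype ι] (hF : F ≤ m)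
    {Y : Ω → EuclideanSpace ℝ ι} (hY : StronglyMeasurable[m] Y) (hY1 : ∀ ω, ‖Y ω‖ ≤ 1)
    (hNA : ∀ ξ : Ω → EuclideanSpace ℝ ι, StronglyMeasurable[F] ξ →
      (∀ᵐ ω ∂P, 0 ≤ inner ℝ (ξ ω) (Y ω)) → ∀ᵐ ω ∂P, inner ℝ (ξ ω) (Y ω) = 0) :
    ∃ z : Ω → ℝ, Measurable[m] z ∧ (∀ ω, 0 < z ω) ∧ Integrable z P ∧
      ∀ η : Ω → EuclideanSpace ℝ ι, StronglyMeasurable[F] η → (∀ ω, ‖η ω‖ ≤ 1) →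
        ∫ ω, z ω * inner ℝ (η ω) (Y ω) ∂P = 0 := by
  obtain ⟨ξ, u, hξ, hu, hmin⟩ := exists_exponential_minimiser (P := P) (hF := hF) hY hY1
  have hu0 := ae_ne_zero_of_tendsto_exp (EuclideanSpace.basisFun ι ℝ) hY hY1 hNA hξ hu
  -- the density is `u ^ 2`, modified on a null set to be positive everywhere
  have hz : (fun ω => if u ω = 0 then 1 else u ω ^ 2) =ᵐ[P] fun ω => u ω ^ 2 := by
    filter_upwards [hu0] with ω h
    rw [if_neg h]
  have hum : Measurable[m] fun ω => u ω := (Lp.stronglyMeasurable u).measurable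
  refine ⟨fun ω => if u ω = 0 then 1 else u ω ^ 2, ?_, fun ω => ?_,
    (Lp.memLp u).integrable_sq.congr hz.symm, fun η hη hη1 => ?_⟩
  · exact Measurable.ite (hum (measurableSet_singleton 0)) measurable_const (hum.pow_const 2)
  · dsimp only
    split_ifs with h
    · exact one_pos
    · positivity
  · refine (integral_congr_ae ?_).trans
      (integral_gain_eq_zero_of_minimal hY hY1 hF hmin hη hη1)
    filter_upwards [hu0] with ω h
    rw [if_neg h]

end OnePeriod

/-! ### One period: conditional densities for nonnegative prices -/

/-- Equivalent finite measures have a real density which is positive everywhere. -/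
lemma exists_pos_withDensity {Ω : Type*} {m : MeasurableSpace Ω} {Q P : Measure Ω}
    [IsFiniteMeasure Q] [IsFiniteMeasure P] (h1 : Q ≪ P) (h2 : P ≪ Q) :
    ∃ D : Ω → ℝ, Measurable D ∧ (∀ ω, 0 < D ω) ∧
      Q = P.withDensity fun ω => ENNReal.ofReal (D ω) := by
  have hm : Measurable fun ω => (Q.rnDeriv P ω).toReal :=
    (Measure.measurable_rnDeriv Q P).ennreal_toReal
  have hpos : ∀ᵐ ω ∂P, 0 < (Q.rnDeriv P ω).toReal ∧
      ENNReal.ofReal (Q.rnDeriv P ω).toReal = Q.rnDeriv P ω := by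
    filter_upwards [h2.ae_le (Measure.rnDeriv_pos h1), Measure.rnDeriv_lt_top Q P] with ω h3 h4
    exact ⟨ENNReal.toReal_pos h3.ne' h4.ne, ENNReal.ofReal_toReal h4.ne⟩
  refine ⟨fun ω => if 0 < (Q.rnDeriv P ω).toReal then (Q.rnDeriv P ω).toReal else 1,
    Measurable.ite (measurableSet_lt measurable_const hm) hm measurable_const, fun ω => ?_, ?_⟩
  · dsimp only
    split_ifs with h
    · exact h
    · exact one_pos
  · rw [← Measure.withDensity_rnDeriv_eq Q P h1]
    refine withDensity_congr_ae ?_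
    rw [Measure.withDensity_rnDeriv_eq Q P h1]
    filter_upwards [hpos] with ω h
    rw [if_pos h.1, h.2]

lemma lintegral_mul_eq_of_forall_setLIntegral_eq {Ω : Type*} {F m : MeasurableSpace Ω}
    {P : Measure Ω} (hF : F ≤ m) {g₁ g₂ : Ω → ENNReal} (hg₁ : Measurable[m] g₁)
    (hg₂ : Measurable[m] g₂)
    (h : ∀ A, MeasurableSet[F] A → ∫⁻ ω in A, g₁ ω ∂P = ∫⁻ ω in A, g₂ ω ∂P)
    {φ : Ω → ENNReal} (hφ : Measurable[F] φ) :
    ∫⁻ ω, φ ω * g₁ ω ∂P = ∫⁻ ω, φ ω * g₂ ω ∂P := by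
  have h1 : (P.withDensity g₁).trim hF = (P.withDensity g₂).trim hF := by
    refine @Measure.ext _ F _ _ fun A hA => ?_
    rw [trim_measurableSet_eq hF hA, trim_measurableSet_eq hF hA, withDensity_apply _ (hF A hA),
      withDensity_apply _ (hF A hA), h A hA]
  have h2 : ∀ g : Ω → ENNReal, Measurable[m] g →
      ∫⁻ ω, φ ω * g ω ∂P = ∫⁻ ω, φ ω ∂(P.withDensity g).trim hF := fun g hg => by
    rw [lintegral_trim hF hφ, lintegral_withDensity_eq_lintegral_mul _ hg (hφ.mono hF le_rfl)]
    simp only [Pi.mul_apply, mul_comm]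
  rw [h2 _ hg₁, h2 _ hg₂, h1]

lemma euclideanSpace_norm_le_sum {ι : Type*} [Fintype ι] (x : EuclideanSpace ℝ ι) :
    ‖x‖ ≤ ∑ i, |x i| := by
  classical
  conv_lhs => rw [← (EuclideanSpace.basisFun ι ℝ).sum_repr x]
  refine (norm_sum_le _ _).trans (Finset.sum_le_sum fun i _ => ?_)
  simp [norm_smul]

/-- The one-period theorem for nonnegative prices `X₀`, `X₁`: without arbitrage there is a positive
conditional density, given `F`, which prices all assets. Integrals of nonnegative functions are
used because the prices need not be integrable. -/
theorem exists_one_period_density {Ω ι : Type*} [Fintype ι] {F m : MeasurableSpace Ω}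
    {P : Measure Ω} [IsProbabilityMeasure P] (hF : F ≤ m) {X₀ X₁ : ι → Ω → ℝ}
    (hX₀ : ∀ i, Measurable[F] (X₀ i)) (hX₁ : ∀ i, Measurable[m] (X₁ i))
    (hX₀_nonneg : ∀ i, 0 ≤ᵐ[P] X₀ i) (hX₁_nonneg : ∀ i, 0 ≤ᵐ[P] X₁ i)
    (hNA : ∀ ξ : ι → Ω → ℝ, (∀ i, Measurable[F] (ξ i)) →
      (∀ᵐ ω ∂P, 0 ≤ ∑ i, ξ i ω * (X₁ i ω - X₀ i ω)) →
      ∀ᵐ ω ∂P, ∑ i, ξ i ω * (X₁ i ω - X₀ i ω) = 0) :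
    ∃ Z : Ω → ℝ, Measurable[m] Z ∧ (∀ ω, 0 < Z ω) ∧ ∀ φ : Ω → ENNReal, Measurable[F] φ →
      ∫⁻ ω, φ ω * ENNReal.ofReal (Z ω) ∂P = ∫⁻ ω, φ ω ∂P ∧
      ∀ i, ∫⁻ ω, φ ω * ENNReal.ofReal (Z ω) * ENNReal.ofReal (X₁ i ω) ∂P =
        ∫⁻ ω, φ ω * ENNReal.ofReal (X₀ i ω) ∂P := by
  classical
  have hX₀m : ∀ i, Measurable[m] (X₀ i) := fun i => (hX₀ i).mono hF le_rfl
  -- the scaling makes the increments bounded and the prices integrable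
  let n : Ω → ℝ := fun ω => 1 + ∑ i, (|X₀ i ω| + |X₁ i ω|)
  have hn1 : ∀ ω, 1 ≤ n ω := fun ω => by
    have : 0 ≤ ∑ i, (|X₀ i ω| + |X₁ i ω|) := Finset.sum_nonneg fun i _ => by positivity
    simp only [n]
    linarith
  have hn0 : ∀ ω, 0 < n ω := fun ω => one_pos.trans_le (hn1 ω)
  have hnX : ∀ i ω, |X₀ i ω| + |X₁ i ω| ≤ n ω := fun i ω => by
    have : |X₀ i ω| + |X₁ i ω| ≤ ∑ i, (|X₀ i ω| + |X₁ i ω|) :=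
      Finset.single_le_sum (f := fun i => |X₀ i ω| + |X₁ i ω|) (fun i _ => by positivity)
        (Finset.mem_univ i)
    simp only [n]
    linarith
  have hnm : Measurable[m] n := by
    refine measurable_const.add (Finset.measurable_sum _ fun i _ => ?_)
    exact (hX₀m i).abs.add (hX₁ i).abs
  let Y : Ω → EuclideanSpace ℝ ι := fun ω =>
    WithLp.toLp 2 fun i => (n ω)⁻¹ * (X₁ i ω - X₀ i ω)
  have hYm : StronglyMeasurable[m] Y := by
    refine Measurable.stronglyMeasurable ?_
    refine (WithLp.measurable_toLp 2 _).comp (measurable_pi_lambda _ fun i => ?_)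
    exact hnm.inv.mul ((hX₁ i).sub (hX₀m i))
  have hY1 : ∀ ω, ‖Y ω‖ ≤ 1 := fun ω => by
    refine (euclideanSpace_norm_le_sum _).trans ?_
    simp only [Y, abs_mul, abs_of_pos (inv_pos.2 (hn0 ω))]
    rw [← Finset.mul_sum, inv_mul_le_iff₀ (hn0 ω), mul_one]
    refine (Finset.sum_le_sum fun i _ => ?_).trans (le_add_of_nonneg_left zero_le_one)
    rw [add_comm]
    exact abs_sub _ _
  have hinner : ∀ (x : EuclideanSpace ℝ ι) ω,
      inner ℝ x (Y ω) = (n ω)⁻¹ * ∑ i, x i * (X₁ i ω - X₀ i ω) := fun x ω => by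
    rw [PiLp.inner_apply, Finset.mul_sum]
    refine Finset.sum_congr rfl fun i _ => ?_
    simp only [Y, RCLike.inner_apply, conj_trivial]
    ring
  obtain ⟨z, hzm, hz0, hzi, hz⟩ := exists_pos_integrable_integral_gain_eq_zero hF hYm hY1
    (P := P) fun ξ hξ h => by
      have h1 := hNA (fun i ω => ξ ω i)
        (fun i => (measurable_pi_apply i).comp
          ((WithLp.measurable_ofLp 2 _).comp hξ.measurable)) (by
          filter_upwards [h] with ω h2
          rw [hinner] at h2
          exact nonneg_of_mul_nonneg_right h2 (inv_pos.2 (hn0 ω)))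
      filter_upwards [h1] with ω h2
      rw [hinner, h2, mul_zero]
  let W : Ω → ℝ := fun ω => z ω * (n ω)⁻¹
  have hWm : Measurable[m] W := hzm.mul hnm.inv
  have hW0 : ∀ ω, 0 < W ω := fun ω => mul_pos (hz0 ω) (inv_pos.2 (hn0 ω))
  have hWi : ∀ X : Ω → ℝ, Measurable[m] X → (∀ ω, |X ω| ≤ n ω) →
      Integrable (fun ω => W ω * X ω) P := fun X hX hXn => by
    refine hzi.mono' (hWm.mul hX).aestronglyMeasurable (ae_of_all _ fun ω => ?_)
    rw [Real.norm_eq_abs, abs_mul, abs_of_pos (hW0 ω)]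
    refine (mul_le_mul_of_nonneg_left (hXn ω) (hW0 ω).le).trans_eq ?_
    simp only [W]
    rw [mul_assoc, inv_mul_cancel₀ (hn0 ω).ne', mul_one]
  have hW₀ := fun i => hWi (X₀ i) (hX₀m i)
    fun ω => (le_add_of_nonneg_right (abs_nonneg _)).trans (hnX i ω)
  have hW₁ := fun i => hWi (X₁ i) (hX₁ i)
    fun ω => (le_add_of_nonneg_left (abs_nonneg _)).trans (hnX i ω)
  have hset : ∀ i A, MeasurableSet[F] A →
      ∫ ω in A, W ω * X₁ i ω ∂P = ∫ ω in A, W ω * X₀ i ω ∂P := by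
    intro i A hA
    have h1 := hz (A.indicator fun _ => EuclideanSpace.single i 1)
      (stronglyMeasurable_const.indicator hA) fun ω => by
        refine (norm_indicator_le_norm_self _ _).trans ?_
        simp
    rw [← sub_eq_zero, ← integral_sub (hW₁ i).integrableOn (hW₀ i).integrableOn,
      ← integral_indicator (hF _ hA), ← h1]
    congr 1 with ω
    rw [hinner]
    by_cases hω : ω ∈ A
    · simp only [Set.indicator_of_mem hω, W]
      simp
      ring
    · simp [Set.indicator_of_notMem hω]
  have hlset : ∀ i A, MeasurableSet[F] A →
      ∫⁻ ω in A, ENNReal.ofReal (W ω * X₁ i ω) ∂P =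
        ∫⁻ ω in A, ENNReal.ofReal (W ω * X₀ i ω) ∂P := by
    intro i A hA
    rw [← ofReal_integral_eq_lintegral_ofReal (hW₁ i).integrableOn,
      ← ofReal_integral_eq_lintegral_ofReal (hW₀ i).integrableOn, hset i A hA]
    · refine ae_restrict_of_ae ?_
      filter_upwards [hX₀_nonneg i] with ω h using mul_nonneg (hW0 ω).le h
    · refine ae_restrict_of_ae ?_
      filter_upwards [hX₁_nonneg i] with ω h using mul_nonneg (hW0 ω).le h
  have hWint : Integrable W P := by
    simpa using hWi (fun _ => 1) measurable_const fun ω => by simpa using hn1 ω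
  -- `w` is the conditional expectation of `W` given `F`, and `W / w` the conditional density
  have : IsFiniteMeasure (P.withDensity fun ω => ENNReal.ofReal (W ω)) :=
    isFiniteMeasure_withDensity_ofReal hWint.2
  obtain ⟨w, hwm, hw0, hw⟩ := exists_pos_withDensity
    (Q := (P.withDensity fun ω => ENNReal.ofReal (W ω)).trim hF) (P := P.trim hF)
    ((withDensity_absolutelyContinuous _ _).trim hF)
    ((withDensity_absolutelyContinuous' hWm.ennreal_ofReal.aemeasurable
      (ae_of_all _ fun ω => (ENNReal.ofReal_pos.2 (hW0 ω)).ne')).trim hF)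
  have hwm' : Measurable[m] w := hwm.mono hF le_rfl
  have hWw : ∀ φ : Ω → ENNReal, Measurable[F] φ →
      ∫⁻ ω, φ ω * ENNReal.ofReal (W ω) ∂P = ∫⁻ ω, φ ω * ENNReal.ofReal (w ω) ∂P := by
    intro φ hφ
    refine lintegral_mul_eq_of_forall_setLIntegral_eq hF hWm.ennreal_ofReal hwm'.ennreal_ofReal
      (fun A hA => ?_) hφ
    rw [← withDensity_apply _ (hF _ hA), ← trim_measurableSet_eq hF hA, hw,
      withDensity_apply _ hA, restrict_trim hF P hA, lintegral_trim hF hwm.ennreal_ofReal]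
  have hwinv : ∀ ω, ENNReal.ofReal (w ω)⁻¹ * ENNReal.ofReal (w ω) = 1 := fun ω => by
    rw [← ENNReal.ofReal_mul (inv_nonneg.2 (hw0 ω).le), inv_mul_cancel₀ (hw0 ω).ne',
      ENNReal.ofReal_one]
  refine ⟨fun ω => (w ω)⁻¹ * W ω, hwm'.inv.mul hWm,
    fun ω => mul_pos (inv_pos.2 (hw0 ω)) (hW0 ω), fun φ hφ => ⟨?_, fun i => ?_⟩⟩
  · have h1 := hWw (fun ω => φ ω * ENNReal.ofReal (w ω)⁻¹) (hφ.mul hwm.inv.ennreal_ofReal)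
    simp only [mul_assoc, hwinv, mul_one] at h1
    rw [← h1]
    simp only [ENNReal.ofReal_mul (inv_nonneg.2 (hw0 _).le)]
  · have h1 := lintegral_mul_eq_of_forall_setLIntegral_eq hF
      (hWm.mul (hX₁ i)).ennreal_ofReal (hWm.mul (hX₀m i)).ennreal_ofReal (hlset i)
      (hφ.mul hwm.inv.ennreal_ofReal)
    have h2 := hWw (fun ω => φ ω * ENNReal.ofReal (w ω)⁻¹ * ENNReal.ofReal (X₀ i ω))
      ((hφ.mul hwm.inv.ennreal_ofReal).mul (hX₀ i).ennreal_ofReal)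
    have h3 : ∀ ω, φ ω * ENNReal.ofReal (w ω)⁻¹ * ENNReal.ofReal (X₀ i ω) * ENNReal.ofReal (w ω) =
        φ ω * ENNReal.ofReal (X₀ i ω) := fun ω => by
      rw [mul_right_comm, mul_assoc (φ ω), hwinv, mul_one]
    simp only [h3] at h2
    simp only [Pi.mul_apply, ENNReal.ofReal_mul (hW0 _).le] at h1
    rw [← h2]
    simp only [ENNReal.ofReal_mul (inv_nonneg.2 (hw0 _).le)]
    simp only [Pi.inv_apply, mul_assoc, mul_comm, mul_left_comm] at h1 ⊢
    exact h1

/-! ### Predictability in discrete time and change of measure -/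

section Predictable

variable {Ω : Type*} {m : MeasurableSpace Ω} {T : ℕ}

lemma isStronglyPredictable_iff {ℱ : Filtration (Fin (T + 1)) m} {u : Fin (T + 1) → Ω → ℝ} :
    IsStronglyPredictable ℱ u ↔
      Measurable[ℱ 0] (u 0) ∧ ∀ k : Fin T, Measurable[ℱ k.castSucc] (u k.succ) := by
  constructor
  · intro h
    refine ⟨(h.stronglyAdapted 0).measurable, fun k => ?_⟩
    have h1 : @Measurable Ω (Fin (T + 1) × Ω) (ℱ k.castSucc) ℱ.predictable
        fun ω => (k.succ, ω) := by
      refine @measurable_generateFrom _ _ (ℱ k.castSucc) _ _ ?_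
      rintro - (⟨A, hA, rfl⟩ | ⟨i, A, hA, rfl⟩)
      · convert @MeasurableSet.empty _ (ℱ k.castSucc)
        ext ω
        simp [show k.succ ≠ ⊥ from Fin.succ_ne_zero k]
      · by_cases hi : i < k.succ
        · convert ℱ.mono (Fin.le_castSucc_iff.2 hi) _ hA
          ext ω
          simp [hi]
        · convert @MeasurableSet.empty _ (ℱ k.castSucc)
          ext ω
          simp [hi]
    exact (StronglyMeasurable.measurable h).comp h1
  · rintro ⟨h0, h1⟩
    suffices Measurable[ℱ.predictable] (Function.uncurry u) from this.stronglyMeasurable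
    intro s hs
    have h2 : Function.uncurry u ⁻¹' s = ⋃ t : Fin (T + 1), {t} ×ˢ (u t ⁻¹' s) := by
      ext ⟨t, ω⟩
      simp [Function.uncurry]
    rw [h2]
    refine MeasurableSet.iUnion fun t => ?_
    induction t using Fin.cases with
    | zero => exact measurableSet_predictable_singleton_bot_prod (h0 hs)
    | succ k =>
      have h3 : ({k.succ} : Set (Fin (T + 1))) = Set.Ioc k.castSucc k.succ := by
        ext t
        simp only [Set.mem_singleton_iff, Set.mem_Ioc, Fin.ext_iff, Fin.lt_def, Fin.le_def,
          Fin.val_succ, Fin.val_castSucc]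
        omega
      rw [h3]
      exact measurableSet_predictable_Ioc_prod _ _ (h1 k hs)

end Predictable

section Martingale

variable {Ω : Type*} {m : MeasurableSpace Ω} {T : ℕ}

lemma martingale_of_setIntegral_eq {ι : Type*} [Preorder ι] {ℱ : Filtration ι m} {μ : Measure Ω}
    [IsFiniteMeasure μ] {M : ι → Ω → ℝ} (hM : StronglyAdapted ℱ M) (hi : ∀ t, Integrable (M t) μ)
    (h : ∀ s t, s ≤ t → ∀ A, MeasurableSet[ℱ s] A → ∫ ω in A, M t ω ∂μ = ∫ ω in A, M s ω ∂μ) :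
    Martingale M ℱ μ :=
  ⟨hM, fun s t hst => (ae_eq_condExp_of_forall_setIntegral_eq (ℱ.le s) (hi t)
    (fun _ _ _ => (hi s).integrableOn) (fun A hA _ => (h s t hst A hA).symm)
    (hM s).aestronglyMeasurable).symm⟩

lemma martingale_congr_ae {ι : Type*} [Preorder ι] {ℱ : Filtration ι m} {μ : Measure Ω}
    {M N : ι → Ω → ℝ} (hM : Martingale M ℱ μ) (hN : StronglyAdapted ℱ N)
    (h : ∀ t, M t =ᵐ[μ] N t) : Martingale N ℱ μ :=
  ⟨hN, fun s t hst => (condExp_congr_ae (h t).symm).trans ((hM.2 s t hst).trans (h s))⟩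

lemma integrable_iff_of_trim_eq_withDensity {F m₁ : MeasurableSpace Ω} {h₁ : F ≤ m₁} {h : F ≤ m}
    {Q : @Measure Ω m₁} {P : @Measure Ω m} {D : Ω → ℝ} (hD : Measurable[F] D) (hD0 : ∀ ω, 0 < D ω)
    (hQ : Q.trim h₁ = (P.trim h).withDensity fun ω => ENNReal.ofReal (D ω)) {g : Ω → ℝ}
    (hg : StronglyMeasurable[F] g) :
    Integrable g Q ↔ Integrable (fun ω => g ω * D ω) P := by
  have h1 : Integrable g Q ↔ Integrable g (Q.trim h₁) :=
    ⟨fun hi => hi.trim h₁ hg, fun hi => integrable_of_integrable_trim h₁ hi⟩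
  have h2 : Integrable (fun ω => g ω * D ω) P ↔ Integrable (fun ω => g ω * D ω) (P.trim h) :=
    ⟨fun hi => hi.trim h (hg.mul hD.stronglyMeasurable),
      fun hi => integrable_of_integrable_trim h hi⟩
  rw [h1, h2, hQ, integrable_withDensity_iff hD.ennreal_ofReal
    (ae_of_all _ fun ω => ENNReal.ofReal_lt_top)]
  simp only [ENNReal.toReal_ofReal (hD0 _).le]

lemma integral_withDensity_ofReal {μ : Measure Ω} {D : Ω → ℝ} (hD : Measurable D)
    (hD0 : ∀ ω, 0 < D ω) (g : Ω → ℝ) :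
    ∫ ω, g ω ∂μ.withDensity (fun ω => ENNReal.ofReal (D ω)) = ∫ ω, g ω * D ω ∂μ := by
  rw [integral_withDensity_eq_integral_toReal_smul hD.ennreal_ofReal
      (ae_of_all _ fun ω => ENNReal.ofReal_lt_top)]
  refine integral_congr_ae (ae_of_all _ fun ω => ?_)
  simp [ENNReal.toReal_ofReal (hD0 ω).le, mul_comm]

lemma setIntegral_eq_of_trim_eq_withDensity {F m₁ : MeasurableSpace Ω} {h₁ : F ≤ m₁} {h : F ≤ m}
    {Q : @Measure Ω m₁} {P : @Measure Ω m} {D : Ω → ℝ} (hD : Measurable[F] D) (hD0 : ∀ ω, 0 < D ω)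
    (hQ : Q.trim h₁ = (P.trim h).withDensity fun ω => ENNReal.ofReal (D ω)) {g : Ω → ℝ}
    (hg : StronglyMeasurable[F] g) {A : Set Ω} (hA : MeasurableSet[F] A) :
    ∫ ω in A, g ω ∂Q = ∫ ω in A, g ω * D ω ∂P := by
  have hgA : StronglyMeasurable[F] (A.indicator g) := hg.indicator hA
  have hgD : StronglyMeasurable[F] (A.indicator fun ω => g ω * D ω) :=
    (hg.mul hD.stronglyMeasurable).indicator hA
  rw [← integral_indicator (h₁ _ hA), ← integral_indicator (h _ hA), integral_trim h₁ hgA,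
    integral_trim h hgD, hQ, integral_withDensity_ofReal hD hD0]
  refine integral_congr_ae (ae_of_all _ fun ω => ?_)
  by_cases hω : ω ∈ A <;> simp [hω]

/-- Bayes' rule: if `D` is the density process of `Q` with respect to `P`, then `M` is a
`Q`-martingale if and only if `M D` is a `P`-martingale. -/
lemma martingale_terminalFiltration_iff {ℱ : Filtration (Fin (T + 1)) m} {P : Measure Ω}
    [IsFiniteMeasure P] {Q : @Measure Ω (ℱ (Fin.last T))} [IsFiniteMeasure Q]
    {D M : Fin (T + 1) → Ω → ℝ} (hD : ∀ t, Measurable[ℱ t] (D t)) (hD0 : ∀ t ω, 0 < D t ω)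
    (hQ : ∀ t, Q.trim (ℱ.mono (Fin.le_last t)) =
      (P.trim (ℱ.le t)).withDensity fun ω => ENNReal.ofReal (D t ω))
    (hM : StronglyAdapted ℱ M) :
    Martingale M (terminalFiltration ℱ) Q ↔ Martingale (fun t ω => M t ω * D t ω) ℱ P := by
  have hint := fun t =>
    integrable_iff_of_trim_eq_withDensity (hD t) (hD0 t) (hQ t) (hM t)
  have hset : ∀ s t, s ≤ t → ∀ A, MeasurableSet[ℱ s] A →
      ∫ ω in A, M t ω ∂Q = ∫ ω in A, M t ω * D t ω ∂P := fun s t hst A hA =>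
    setIntegral_eq_of_trim_eq_withDensity (hD t) (hD0 t) (hQ t) (hM t) (ℱ.mono hst A hA)
  constructor
  · intro h
    refine martingale_of_setIntegral_eq (fun t => (hM t).mul (hD t).stronglyMeasurable)
      (fun t => (hint t).1 (h.integrable t)) fun s t hst A hA => ?_
    rw [← hset s t hst A hA, ← hset s s le_rfl A hA]
    exact (h.setIntegral_eq hst hA).symm
  · intro h
    refine martingale_of_setIntegral_eq hM
      (fun t => (hint t).2 (h.integrable t)) fun s t hst A hA => ?_
    rw [hset s t hst A hA, hset s s le_rfl A hA]
    exact (h.setIntegral_eq hst hA).symm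

/-- A positive martingale starting in `1` is the density process of an equivalent probability
measure. -/
lemma exists_measure_of_martingale {ℱ : Filtration (Fin (T + 1)) m} {P : Measure Ω}
    [IsProbabilityMeasure P] {D : Fin (T + 1) → Ω → ℝ} (hD0 : ∀ t ω, 0 < D t ω)
    (hD1 : ∀ ω, D 0 ω = 1) (hD : Martingale D ℱ P) :
    ∃ Q : @Measure Ω (ℱ (Fin.last T)), IsProbabilityMeasure Q ∧ Q ≪ P.trim (ℱ.le (Fin.last T)) ∧
      P.trim (ℱ.le (Fin.last T)) ≪ Q ∧
      ∀ t, Q.trim (ℱ.mono (Fin.le_last t)) =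
        (P.trim (ℱ.le t)).withDensity fun ω => ENNReal.ofReal (D t ω) := by
  have hDm : ∀ t, Measurable[ℱ t] (D t) := fun t => (hD.stronglyMeasurable t).measurable
  let Q : @Measure Ω (ℱ (Fin.last T)) := (P.trim (ℱ.le (Fin.last T))).withDensity
    fun ω => ENNReal.ofReal (D (Fin.last T) ω)
  have hdens : ∀ t A, MeasurableSet[ℱ t] A →
      (P.trim (ℱ.le t)).withDensity (fun ω => ENNReal.ofReal (D t ω)) A =
        ENNReal.ofReal (∫ ω in A, D t ω ∂P) := fun t A hA => by
    rw [withDensity_apply _ hA, restrict_trim _ _ hA, lintegral_trim _ (hDm t).ennreal_ofReal,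
      ofReal_integral_eq_lintegral_ofReal (hD.integrable t).integrableOn
        (ae_of_all _ fun ω => (hD0 t ω).le)]
  have hQ : ∀ t A, MeasurableSet[ℱ t] A → Q A = ENNReal.ofReal (∫ ω in A, D t ω ∂P) :=
    fun t A hA => by
      rw [hdens (Fin.last T) A (ℱ.mono (Fin.le_last t) _ hA),
        hD.setIntegral_eq (Fin.le_last t) hA]
  refine ⟨Q, ⟨?_⟩, withDensity_absolutelyContinuous _ _,
    withDensity_absolutelyContinuous' (hDm _).ennreal_ofReal.aemeasurable
      (ae_of_all _ fun ω => (ENNReal.ofReal_pos.2 (hD0 _ ω)).ne'), fun t => ?_⟩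
  · rw [hQ 0 Set.univ MeasurableSet.univ]
    simp [hD1]
  · refine @Measure.ext _ (ℱ t) _ _ fun A hA => ?_
    rw [trim_measurableSet_eq _ hA, hdens t A hA, hQ t A hA]

end Martingale

/-! ### From no arbitrage to a martingale density -/

section Strategies

variable {Ω : Type*} {m : MeasurableSpace Ω} {T : ℕ} {ι : Type*} [Fintype ι]

lemma stochInt_zero (δ S : ι → Fin (T + 1) → Ω → ℝ) (ω : Ω) : stochInt δ S 0 ω = 0 := by
  rw [stochInt, Finset.filter_false_of_mem, Finset.sum_empty]
  intro k _
  simp [Fin.succ_ne_zero]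

lemma stochInt_succ (δ S : ι → Fin (T + 1) → Ω → ℝ) (k : Fin T) (ω : Ω) :
    stochInt δ S k.succ ω = stochInt δ S k.castSucc ω +
      ∑ i, δ i k.succ ω * (S i k.succ ω - S i k.castSucc ω) := by
  classical
  have h : (Finset.univ.filter fun j : Fin T => j.succ ≤ k.succ) =
      insert k (Finset.univ.filter fun j : Fin T => j.succ ≤ k.castSucc) := by
    ext j
    simp only [Finset.mem_filter, Finset.mem_univ, true_and, Finset.mem_insert, Fin.ext_iff,
      Fin.le_def, Fin.val_succ, Fin.val_castSucc]
    omega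
  rw [stochInt, h, Finset.sum_insert, add_comm, stochInt]
  simp [Fin.le_def]

lemma portfolio_eq_add_stochInt {S δ : ι → Fin (T + 1) → Ω → ℝ} {ω : Ω}
    (h : ∀ k : Fin T, portfolio S δ k.succ ω = portfolio S δ k.castSucc ω +
      ∑ i, δ i k.succ ω * (S i k.succ ω - S i k.castSucc ω)) (t : Fin (T + 1)) :
    portfolio S δ t ω = portfolio S δ 0 ω + stochInt δ S t ω := by
  induction t using Fin.induction with
  | zero => rw [stochInt_zero, add_zero]
  | succ k ih => rw [h k, ih, stochInt_succ, add_assoc]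

lemma portfolio_addAsset (S : ι → Fin (T + 1) → Ω → ℝ) (B : Fin (T + 1) → Ω → ℝ)
    (δ : Option ι → Fin (T + 1) → Ω → ℝ) (t : Fin (T + 1)) (ω : Ω) :
    portfolio (addAsset S B) δ t ω = δ none t ω * B t ω + ∑ i, δ (some i) t ω * S i t ω :=
  Fintype.sum_option _

lemma IsSavingsAccount.measurable {ℱ : Filtration (Fin (T + 1)) m} {B : Fin (T + 1) → Ω → ℝ}
    (hB : IsSavingsAccount ℱ B) (t : Fin (T + 1)) : Measurable[ℱ t] (B t) :=
  (hB.predictable.stronglyAdapted t).measurable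

omit [Fintype ι] in
lemma measurable_discounted {ℱ : Filtration (Fin (T + 1)) m} {S : ι → Fin (T + 1) → Ω → ℝ}
    (hS : ∀ i, StronglyAdapted ℱ (S i)) {B : Fin (T + 1) → Ω → ℝ} (hB : IsSavingsAccount ℱ B)
    (i : ι) (t : Fin (T + 1)) : Measurable[ℱ t] (discounted S B i t) :=
  (hS i t).measurable.mul (hB.measurable t).inv

/-- The strategy that holds the portfolio `ξ` of risky assets during the period `k`, financed by the
savings account `B`, in which the gain is invested afterwards. -/
noncomputable def onePeriodStrategy (S : ι → Fin (T + 1) → Ω → ℝ) (B : Fin (T + 1) → Ω → ℝ)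
    (k : Fin T) (ξ : ι → Ω → ℝ) : Option ι → Fin (T + 1) → Ω → ℝ
  | some i => fun t ω => if t = k.succ then ξ i ω else 0
  | none => fun t ω =>
      if t < k.succ then 0
      else if t = k.succ then -∑ i, ξ i ω * discounted S B i k.castSucc ω
      else ∑ i, ξ i ω * (discounted S B i k.succ ω - discounted S B i k.castSucc ω)

lemma portfolio_onePeriodStrategy {S : ι → Fin (T + 1) → Ω → ℝ} {B : Fin (T + 1) → Ω → ℝ}
    (hB : ∀ t ω, 0 < B t ω) (k : Fin T) (ξ : ι → Ω → ℝ) (t : Fin (T + 1)) (ω : Ω) :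
    portfolio (addAsset S B) (onePeriodStrategy S B k ξ) t ω =
      if t < k.succ then 0
      else (∑ i, ξ i ω * (discounted S B i k.succ ω - discounted S B i k.castSucc ω)) * B t ω := by
  rw [portfolio_addAsset]
  rcases lt_trichotomy t k.succ with h | h | h
  · simp [onePeriodStrategy, h, h.ne]
  · subst h
    have h1 : ∀ i, S i k.succ ω = discounted S B i k.succ ω * B k.succ ω := fun i => by
      rw [discounted, inv_mul_cancel_right₀ (hB _ ω).ne']
    simp only [onePeriodStrategy, lt_irrefl, if_false, if_true, h1, mul_sub,
      Finset.sum_sub_distrib, Finset.sum_mul, sub_mul, mul_assoc]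
    rw [neg_mul, Finset.sum_mul]
    simp only [mul_assoc]
    ring
  · simp [onePeriodStrategy, h.not_gt, h.ne']

lemma isSelfFinancing_onePeriodStrategy {ℱ : Filtration (Fin (T + 1)) m} {P : Measure Ω}
    {S : ι → Fin (T + 1) → Ω → ℝ} (hS : ∀ i, StronglyAdapted ℱ (S i)) {B : Fin (T + 1) → Ω → ℝ}
    (hB : IsSavingsAccount ℱ B) (k : Fin T) {ξ : ι → Ω → ℝ}
    (hξ : ∀ i, Measurable[ℱ k.castSucc] (ξ i)) :
    IsSelfFinancing ℱ P (addAsset S B) (onePeriodStrategy S B k ξ) := by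
  have hX := measurable_discounted hS hB
  refine ⟨fun i => isStronglyPredictable_iff.2 ?_, fun t => ae_of_all _ fun ω =>
    portfolio_eq_add_stochInt (fun j => ?_) t⟩
  · rcases i with _ | i
    · refine ⟨?_, fun j => ?_⟩
      · simp only [onePeriodStrategy, Fin.succ_pos, if_true]
        exact measurable_const
      · rcases lt_trichotomy j k with h | h | h
        · simp only [onePeriodStrategy, Fin.succ_lt_succ_iff, h, if_true]
          exact measurable_const
        · subst h
          simp only [onePeriodStrategy, lt_irrefl, if_false, if_true]
          exact (Finset.measurable_sum _ fun i _ => (hξ i).mul (hX i _)).neg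
        · have h1 : k.succ ≤ j.castSucc := by
            rw [Fin.le_def, Fin.val_succ, Fin.val_castSucc]
            exact h
          have h2 : k.castSucc ≤ j.castSucc := Fin.castSucc_le_castSucc_iff.2 h.le
          simp only [onePeriodStrategy, Fin.succ_lt_succ_iff, h.not_gt, Fin.succ_inj, h.ne',
            if_false]
          exact Finset.measurable_sum _ fun i _ => ((hξ i).mono (ℱ.mono h2) le_rfl).mul
            (((hX i _).mono (ℱ.mono h1) le_rfl).sub ((hX i _).mono (ℱ.mono h2) le_rfl))
    · refine ⟨?_, fun j => ?_⟩
      · simp only [onePeriodStrategy, (Fin.succ_ne_zero k).symm, if_false]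
        exact measurable_const
      · by_cases h : j = k
        · subst h
          simpa only [onePeriodStrategy, if_true] using hξ i
        · simp only [onePeriodStrategy, Fin.succ_inj, h, if_false]
          exact measurable_const
  · rw [portfolio_onePeriodStrategy hB.pos, portfolio_onePeriodStrategy hB.pos, Fintype.sum_option]
    rcases lt_trichotomy j k with h | h | h
    · have h1 : j.castSucc < k.succ := by
        rw [Fin.lt_def, Fin.val_succ, Fin.val_castSucc]
        exact Nat.lt_succ_of_lt h
      simp [onePeriodStrategy, h, h.ne, h1]
    · subst h
      have h1 : ∀ i t, S i t ω = discounted S B i t ω * B t ω := fun i t => by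
        rw [discounted, inv_mul_cancel_right₀ (hB.pos _ ω).ne']
      simp only [onePeriodStrategy, addAsset, lt_irrefl, if_false, if_true, h1, mul_sub, neg_mul,
        Fin.castSucc_lt_succ, Finset.sum_sub_distrib, Finset.sum_mul, sub_mul, mul_assoc]
      ring
    · have h1 : ¬ j.castSucc < k.succ := by
        rw [Fin.lt_def, Fin.val_succ, Fin.val_castSucc, not_lt]
        exact h
      simp only [onePeriodStrategy, addAsset, Fin.succ_lt_succ_iff, Fin.succ_inj, h.not_gt, h.ne',
        h1, if_false, zero_mul, Finset.sum_const_zero]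
      ring

/-- No arbitrage for the market with savings account `B` implies no arbitrage in each period for
the discounted prices. -/
lemma ae_gain_eq_zero_of_satisfiesNA {ℱ : Filtration (Fin (T + 1)) m} {P : Measure Ω}
    {S : ι → Fin (T + 1) → Ω → ℝ} (hS : ∀ i, StronglyAdapted ℱ (S i)) {B : Fin (T + 1) → Ω → ℝ}
    (hB : IsSavingsAccount ℱ B) (hNA : SatisfiesNA (sfOutcomes ℱ P (addAsset S B) 0))
    (k : Fin T) {ξ : ι → Ω → ℝ} (hξ : ∀ i, Measurable[ℱ k.castSucc] (ξ i))
    (h : ∀ᵐ ω ∂P, 0 ≤ ∑ i, ξ i ω * (discounted S B i k.succ ω - discounted S B i k.castSucc ω)) :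
    ∀ᵐ ω ∂P, ∑ i, ξ i ω * (discounted S B i k.succ ω - discounted S B i k.castSucc ω) = 0 := by
  have hX := fun i t => (measurable_discounted hS hB i t).mono (ℱ.le t) le_rfl
  have hm : Measurable[m] fun ω =>
      (∑ i, ξ i ω * (discounted S B i k.succ ω - discounted S B i k.castSucc ω)) *
        B (Fin.last T) ω :=
    (Finset.measurable_sum _ fun i _ =>
      ((hξ i).mono (ℱ.le _) le_rfl).mul ((hX i _).sub (hX i _))).mul
        ((hB.measurable _).mono (ℱ.le _) le_rfl)
  have hport := portfolio_onePeriodStrategy (S := S) hB.pos k ξ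
  have hlast : ¬ Fin.last T < k.succ := not_lt.2 (Fin.le_last _)
  have hmem : AEEqFun.mk _ hm.aestronglyMeasurable ∈
      sfOutcomes ℱ P (addAsset S B) 0 ∩ {f | 0 ≤ f} := by
    refine ⟨⟨onePeriodStrategy S B k ξ, isSelfFinancing_onePeriodStrategy hS hB k hξ, ?_, ?_⟩, ?_⟩
    · exact ae_of_all _ fun ω => by rw [hport, if_pos (Fin.succ_pos k)]
    · filter_upwards [AEEqFun.coeFn_mk _ hm.aestronglyMeasurable] with ω h1
      rw [h1, hport, if_neg hlast]
    · rw [Set.mem_ofPred_eq, ← AEEqFun.coeFn_le]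
      filter_upwards [AEEqFun.coeFn_mk _ hm.aestronglyMeasurable, AEEqFun.coeFn_zero (β := ℝ), h]
        with ω h1 h2 h3
      rw [h1, h2]
      exact mul_nonneg h3 (hB.pos _ ω).le
  rw [hNA, Set.mem_singleton_iff] at hmem
  have h0 := AEEqFun.coeFn_mk _ hm.aestronglyMeasurable (μ := P)
  rw [hmem] at h0
  filter_upwards [h0, AEEqFun.coeFn_zero (β := ℝ)] with ω h1 h2
  rw [h2] at h1
  exact (mul_eq_zero.1 h1.symm).resolve_right (hB.pos _ ω).ne'

end Strategies

section Gluing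

variable {Ω : Type*} {m : MeasurableSpace Ω} {T : ℕ}

lemma lintegral_mul_eq_of_forall_succ {ℱ : Filtration (Fin (T + 1)) m} {P : Measure Ω}
    {N : Fin (T + 1) → Ω → ENNReal}
    (hN : ∀ (k : Fin T) (φ : Ω → ENNReal), Measurable[ℱ k.castSucc] φ →
      ∫⁻ ω, φ ω * N k.succ ω ∂P = ∫⁻ ω, φ ω * N k.castSucc ω ∂P)
    {s t : Fin (T + 1)} (hst : s ≤ t) {φ : Ω → ENNReal} (hφ : Measurable[ℱ s] φ) :
    ∫⁻ ω, φ ω * N t ω ∂P = ∫⁻ ω, φ ω * N s ω ∂P := by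
  induction t using Fin.induction with
  | zero => rw [le_antisymm hst (Fin.zero_le s)]
  | succ k ih =>
    rcases hst.eq_or_lt with h | h
    · rw [h]
    · have h1 : s ≤ k.castSucc := Fin.le_castSucc_iff.2 h
      rw [hN k φ (hφ.mono (ℱ.mono h1) le_rfl), ih h1]

/-- An adapted nonnegative process with constant initial value is a martingale as soon as its
one-step conditional expectations, as integrals of nonnegative functions, are the right ones:
integrability propagates from the initial value. -/
lemma martingale_of_lintegral_succ {ℱ : Filtration (Fin (T + 1)) m} {P : Measure Ω}
    [IsProbabilityMeasure P] {M : Fin (T + 1) → Ω → ℝ} (hM : ∀ t, Measurable[ℱ t] (M t))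
    (hM0 : ∀ t, 0 ≤ᵐ[P] M t) {c : ℝ} (hc : ∀ ω, M 0 ω = c)
    (h : ∀ (k : Fin T) (φ : Ω → ENNReal), Measurable[ℱ k.castSucc] φ →
      ∫⁻ ω, φ ω * ENNReal.ofReal (M k.succ ω) ∂P =
        ∫⁻ ω, φ ω * ENNReal.ofReal (M k.castSucc ω) ∂P) : Martingale M ℱ P := by
  have hMm : ∀ t, Measurable[m] (M t) := fun t => (hM t).mono (ℱ.le t) le_rfl
  have hlint := fun {s t : Fin (T + 1)} (hst : s ≤ t) {φ : Ω → ENNReal} =>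
    lintegral_mul_eq_of_forall_succ (N := fun t ω => ENNReal.ofReal (M t ω)) h hst (φ := φ)
  have hint : ∀ t, Integrable (M t) P := fun t => by
    refine ⟨(hMm t).aestronglyMeasurable, ?_⟩
    rw [hasFiniteIntegral_iff_ofReal (hM0 t)]
    have h1 := hlint (Fin.zero_le t) (φ := fun _ => 1) measurable_const
    simp only [one_mul, hc] at h1
    rw [h1]
    simp
  refine martingale_of_setIntegral_eq (fun t => (hM t).stronglyMeasurable) hint
    fun s t hst A hA => ?_
  have h2 := hlint hst (φ := A.indicator fun _ => 1) (measurable_const.indicator hA)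
  have h3 : ∀ t, ∫ ω in A, M t ω ∂P =
      (∫⁻ ω, A.indicator (fun _ => 1) ω * ENNReal.ofReal (M t ω) ∂P).toReal := fun t => by
    rw [integral_eq_lintegral_of_nonneg_ae (ae_restrict_of_ae (hM0 t))
      (hMm t).aestronglyMeasurable.restrict, ← lintegral_indicator (ℱ.le s _ hA)]
    congr 2 with ω
    by_cases hω : ω ∈ A <;> simp [hω]
  rw [h3, h3, h2]

/-- The product of one-period densities: `densityProcess Z t` is the product of the `Z k` with
`k < t`. -/
noncomputable def densityProcess (Z : Fin T → Ω → ℝ) (t : Fin (T + 1)) : Ω → ℝ :=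
  Fin.induction (motive := fun _ => Ω → ℝ) (fun _ => 1) (fun k L ω => L ω * Z k ω) t

lemma densityProcess_succ (Z : Fin T → Ω → ℝ) (k : Fin T) (ω : Ω) :
    densityProcess Z k.succ ω = densityProcess Z k.castSucc ω * Z k ω := by
  rw [densityProcess, Fin.induction_succ, densityProcess]

/-- Multi-period existence of a martingale density under absence of arbitrage in each period. -/
theorem exists_martingale_density {ι : Type*} [Fintype ι] {ℱ : Filtration (Fin (T + 1)) m}
    {P : Measure Ω} [IsProbabilityMeasure P] {X : ι → Fin (T + 1) → Ω → ℝ}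
    (hX : ∀ i t, Measurable[ℱ t] (X i t)) (hX_nonneg : ∀ i t, 0 ≤ᵐ[P] X i t)
    (hX_zero : ∀ i, ∃ c, ∀ ω, X i 0 ω = c)
    (hNA : ∀ (k : Fin T) (ξ : ι → Ω → ℝ), (∀ i, Measurable[ℱ k.castSucc] (ξ i)) →
      (∀ᵐ ω ∂P, 0 ≤ ∑ i, ξ i ω * (X i k.succ ω - X i k.castSucc ω)) →
      ∀ᵐ ω ∂P, ∑ i, ξ i ω * (X i k.succ ω - X i k.castSucc ω) = 0) :
    ∃ D : Fin (T + 1) → Ω → ℝ, (∀ t ω, 0 < D t ω) ∧ (∀ ω, D 0 ω = 1) ∧ Martingale D ℱ P ∧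
      ∀ i, Martingale (fun t ω => X i t ω * D t ω) ℱ P := by
  have hstep : ∀ k : Fin T, ∃ Z : Ω → ℝ, Measurable[ℱ k.succ] Z ∧ (∀ ω, 0 < Z ω) ∧
      ∀ φ : Ω → ENNReal, Measurable[ℱ k.castSucc] φ →
        ∫⁻ ω, φ ω * ENNReal.ofReal (Z ω) ∂P = ∫⁻ ω, φ ω ∂P ∧
        ∀ i, ∫⁻ ω, φ ω * ENNReal.ofReal (Z ω) * ENNReal.ofReal (X i k.succ ω) ∂P =
          ∫⁻ ω, φ ω * ENNReal.ofReal (X i k.castSucc ω) ∂P := by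
    intro k
    have hle : ℱ k.castSucc ≤ ℱ k.succ := ℱ.mono k.castSucc_lt_succ.le
    have hX' := fun i => (hX i k.castSucc).mono hle le_rfl
    have hnn : ∀ i t, t ≤ k.succ → 0 ≤ᵐ[P.trim (ℱ.le k.succ)] X i t := fun i t ht =>
      (stronglyMeasurable_const.ae_le_trim_iff (ℱ.le k.succ)
        ((hX i t).mono (ℱ.mono ht) le_rfl).stronglyMeasurable).2 (hX_nonneg i t)
    have : IsProbabilityMeasure (P.trim (ℱ.le k.succ)) :=
      ⟨by rw [trim_measurableSet_eq _ MeasurableSet.univ, measure_univ]⟩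
    obtain ⟨Z, hZm, hZ0, hZ⟩ := exists_one_period_density (P := P.trim (ℱ.le k.succ)) hle
      (fun i => hX i k.castSucc) (fun i => hX i k.succ)
      (fun i => hnn i _ k.castSucc_lt_succ.le) (fun i => hnn i _ le_rfl) fun ξ hξ h => by
        have hm : Measurable[ℱ k.succ] fun ω => ∑ i, ξ i ω * (X i k.succ ω - X i k.castSucc ω) :=
          Finset.measurable_sum _ fun i _ => ((hξ i).mono hle le_rfl).mul ((hX i _).sub (hX' i))
        exact (hm.stronglyMeasurable.ae_eq_trim_iff (ℱ.le k.succ)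
          stronglyMeasurable_const).2 (hNA k ξ hξ (ae_of_ae_trim _ h))
    refine ⟨Z, hZm, hZ0, fun φ hφ => ?_⟩
    have hφ' : Measurable[ℱ k.succ] φ := hφ.mono hle le_rfl
    obtain ⟨h1, h2⟩ := hZ φ hφ
    have hφZ : Measurable[ℱ k.succ] fun ω => φ ω * ENNReal.ofReal (Z ω) :=
      hφ'.mul hZm.ennreal_ofReal
    have hφX : ∀ i, Measurable[ℱ k.succ] fun ω => φ ω * ENNReal.ofReal (X i k.castSucc ω) :=
      fun i => hφ'.mul (hX' i).ennreal_ofReal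
    have hφZX : ∀ i, Measurable[ℱ k.succ] fun ω =>
        φ ω * ENNReal.ofReal (Z ω) * ENNReal.ofReal (X i k.succ ω) :=
      fun i => hφZ.mul (hX i _).ennreal_ofReal
    rw [lintegral_trim _ hφZ, lintegral_trim _ hφ'] at h1
    refine ⟨h1, fun i => ?_⟩
    rw [← lintegral_trim _ (hφZX i), ← lintegral_trim _ (hφX i)]
    exact h2 i
  choose Z hZm hZ0 hZ1 using hstep
  have hD0 : ∀ t ω, 0 < densityProcess Z t ω := fun t ω => by
    induction t using Fin.induction with
    | zero => exact one_pos
    | succ k ih => rw [densityProcess_succ]; exact mul_pos ih (hZ0 k ω)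
  have hDm : ∀ t, Measurable[ℱ t] (densityProcess Z t) := fun t => by
    induction t using Fin.induction with
    | zero => exact measurable_const
    | succ k ih =>
      exact (ih.mono (ℱ.mono k.castSucc_lt_succ.le) le_rfl).mul (hZm k)
  refine ⟨densityProcess Z, hD0, fun ω => rfl, ?_, fun i => ?_⟩
  · refine martingale_of_lintegral_succ hDm (fun t => ae_of_all _ fun ω => (hD0 t ω).le)
      (c := 1) (fun ω => rfl) fun k φ hφ => ?_
    have h1 := (hZ1 k _ (hφ.mul (hDm k.castSucc).ennreal_ofReal)).1
    simp only [Pi.mul_apply] at h1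
    rw [← h1]
    simp only [densityProcess_succ, ENNReal.ofReal_mul (hD0 _ _).le, mul_assoc]
  · obtain ⟨c, hc⟩ := hX_zero i
    refine martingale_of_lintegral_succ (fun t => (hX i t).mul (hDm t)) (fun t => ?_)
      (c := c) (fun ω => ?_) fun k φ hφ => ?_
    · filter_upwards [hX_nonneg i t] with ω h using mul_nonneg h (hD0 t ω).le
    · rw [hc]
      exact mul_one c
    · have h1 := (hZ1 k _ (hφ.mul (hDm k.castSucc).ennreal_ofReal)).2 i
      simp only [Pi.mul_apply] at h1
      simp only [ENNReal.ofReal_mul' (hD0 _ _).le, ← mul_assoc, mul_right_comm _ _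
        (ENNReal.ofReal (densityProcess Z _ _))]
      rw [← h1]
      simp only [densityProcess_succ, ENNReal.ofReal_mul (hD0 _ _).le, mul_assoc]

end Gluing

/-! ### No arbitrage under a martingale measure, and the equivalence -/

section NoArbitrage

/-- Absence of arbitrage in one period under a martingale measure, for an arbitrary initial capital
`v` and without integrability of the position `ξ`: a nonnegative final wealth forces a nonnegative
initial capital, and there is no gain where the latter is zero. -/
lemma ae_nonneg_and_gain_eq_zero {Ω ι : Type*} [Fintype ι] {F m : MeasurableSpace Ω}
    {μ : Measure Ω} [IsFiniteMeasure μ] (hF : F ≤ m) {Y : ι → Ω → ℝ}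
    (hYi : ∀ i, Integrable (Y i) μ) (hY : ∀ i, μ[Y i|F] =ᵐ[μ] 0) {v : Ω → ℝ}
    (hv : Measurable[F] v) {ξ : ι → Ω → ℝ} (hξ : ∀ i, Measurable[F] (ξ i))
    (h : ∀ᵐ ω ∂μ, 0 ≤ v ω + ∑ i, ξ i ω * Y i ω) :
    ∀ᵐ ω ∂μ, 0 ≤ v ω ∧ (v ω = 0 → ∑ i, ξ i ω * Y i ω = 0) := by
  -- on `A n` all integrals exist, and the expected final wealth is that of `v ≤ 0`
  let A : ℕ → Set Ω := fun n => {ω | v ω ≤ 0} ∩ ({ω | |v ω| ≤ n} ∩ ⋂ i, {ω | |ξ i ω| ≤ n})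
  have hAF : ∀ n, MeasurableSet[F] (A n) := fun n =>
    (measurableSet_le hv measurable_const).inter
      ((measurableSet_le (continuous_abs.measurable.comp hv) measurable_const).inter
        (MeasurableSet.iInter fun i =>
          measurableSet_le (continuous_abs.measurable.comp (hξ i)) measurable_const))
  have key : ∀ n, ∀ᵐ ω ∂μ, ω ∈ A n → v ω = 0 ∧ ∑ i, ξ i ω * Y i ω = 0 := by
    intro n
    have hbd : ∀ i ω, ‖(A n).indicator (ξ i) ω‖ ≤ n := fun i ω => by
      by_cases hω : ω ∈ A n
      · rw [Set.indicator_of_mem hω]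
        exact Set.mem_iInter.1 hω.2.2 i
      · rw [Set.indicator_of_notMem hω, norm_zero]
        positivity
    have hsm : ∀ i, StronglyMeasurable[F] ((A n).indicator (ξ i)) := fun i =>
      ((hξ i).indicator (hAF n)).stronglyMeasurable
    have hi : ∀ i, Integrable (fun ω => (A n).indicator (ξ i) ω * Y i ω) μ := fun i =>
      (hYi i).bdd_mul ((hsm i).mono hF).aestronglyMeasurable (ae_of_all _ (hbd i))
    have hz : ∀ i, ∫ ω, (A n).indicator (ξ i) ω * Y i ω ∂μ = 0 := fun i => by
      rw [← integral_condExp hF]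
      refine integral_eq_zero_of_ae ?_
      filter_upwards [condExp_stronglyMeasurable_mul_of_bound hF (hsm i) (hYi i) n
        (ae_of_all _ (hbd i)), hY i] with ω h1 h2
      refine h1.trans ?_
      rw [Pi.mul_apply, h2, Pi.zero_apply, mul_zero]
    have hvi : Integrable ((A n).indicator v) μ := by
      refine Integrable.of_bound ((hv.indicator (hAF n)).mono hF le_rfl).aestronglyMeasurable n
        (ae_of_all _ fun ω => ?_)
      by_cases hω : ω ∈ A n
      · rw [Set.indicator_of_mem hω]
        exact hω.2.1
      · rw [Set.indicator_of_notMem hω, norm_zero]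
        positivity
    have hv0 : (A n).indicator v ≤ 0 := fun ω => Set.indicator_nonpos (fun ω hω => hω.1) ω
    have hs := integrable_finsetSum Finset.univ fun i _ => hi i
    have hint : ∫ ω, ((A n).indicator v ω + ∑ i, (A n).indicator (ξ i) ω * Y i ω) ∂μ =
        ∫ ω, (A n).indicator v ω ∂μ := by
      rw [integral_add hvi hs, integral_finsetSum _ fun i _ => hi i]
      simp [hz]
    have hnn : 0 ≤ᵐ[μ] fun ω =>
        (A n).indicator v ω + ∑ i, (A n).indicator (ξ i) ω * Y i ω := by
      filter_upwards [h] with ω h1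
      by_cases hω : ω ∈ A n
      · simpa [hω] using h1
      · simp [hω]
    have h0 : ∫ ω, (A n).indicator v ω ∂μ = 0 := le_antisymm (integral_nonpos hv0)
      (hint ▸ integral_nonneg_of_ae hnn)
    have h1 := (integral_eq_zero_iff_of_nonneg_ae hnn (hvi.add hs)).1 (hint.trans h0)
    have h2 := (integral_eq_zero_iff_of_nonneg (f := -(A n).indicator v)
      (fun ω => neg_nonneg.2 (hv0 ω)) hvi.neg).1 (by
        simp only [Pi.neg_apply]
        rw [integral_neg, h0, neg_zero])
    filter_upwards [h1, h2] with ω h3 h4 hω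
    simp only [Set.indicator_of_mem hω, Pi.zero_apply, Pi.neg_apply, neg_eq_zero] at h3 h4
    exact ⟨h4, by simpa [h4] using h3⟩
  filter_upwards [ae_all_iff.2 key] with ω h1
  by_cases hle : v ω ≤ 0
  · obtain ⟨n, hn⟩ := exists_nat_ge (|v ω| + ∑ i, |ξ i ω|)
    have h2 : 0 ≤ ∑ i, |ξ i ω| := Finset.sum_nonneg fun i _ => abs_nonneg _
    obtain ⟨h3, h4⟩ := h1 n ⟨hle, show |v ω| ≤ n by linarith, Set.mem_iInter.2 fun i => by
      have h5 : |ξ i ω| ≤ ∑ i, |ξ i ω| :=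
        Finset.single_le_sum (f := fun i => |ξ i ω|) (fun i _ => abs_nonneg _) (Finset.mem_univ i)
      change |ξ i ω| ≤ n
      linarith [abs_nonneg (v ω)]⟩
    exact ⟨h3.ge, fun _ => h4⟩
  · exact ⟨(not_le.1 hle).le, fun h2 => absurd h2.le hle⟩

variable {Ω : Type*} {m : MeasurableSpace Ω} {T : ℕ}

/-- Absence of arbitrage in several periods: nonnegativity of the final wealth propagates backwards
in time, and vanishing of the initial wealth then propagates forwards. -/
lemma ae_wealth_eq_zero {ι : Type*} [Fintype ι] {ℱ : Filtration (Fin (T + 1)) m}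
    {μ : Measure Ω} [IsFiniteMeasure μ] {X : ι → Fin (T + 1) → Ω → ℝ}
    (hX : ∀ i, Martingale (X i) ℱ μ) {ξ : ι → Fin (T + 1) → Ω → ℝ}
    (hξ : ∀ i (k : Fin T), Measurable[ℱ k.castSucc] (ξ i k.succ)) {V : Fin (T + 1) → Ω → ℝ}
    (hV : ∀ t, Measurable[ℱ t] (V t)) (hV0 : ∀ᵐ ω ∂μ, V 0 ω = 0)
    (hsucc : ∀ k : Fin T, ∀ᵐ ω ∂μ, V k.succ ω = V k.castSucc ω +
      ∑ i, ξ i k.succ ω * (X i k.succ ω - X i k.castSucc ω))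
    (hT : ∀ᵐ ω ∂μ, 0 ≤ V (Fin.last T) ω) : ∀ᵐ ω ∂μ, V (Fin.last T) ω = 0 := by
  have step : ∀ k : Fin T, (∀ᵐ ω ∂μ, 0 ≤ V k.succ ω) → ∀ᵐ ω ∂μ, 0 ≤ V k.castSucc ω ∧
      (V k.castSucc ω = 0 → ∑ i, ξ i k.succ ω * (X i k.succ ω - X i k.castSucc ω) = 0) := by
    intro k hk
    refine ae_nonneg_and_gain_eq_zero (ℱ.le k.castSucc)
      (fun i => ((hX i).integrable _).sub ((hX i).integrable _)) (fun i => ?_)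
      (hV k.castSucc) (fun i => hξ i k) ?_
    · have h1 := (hX i).2 k.castSucc k.succ k.castSucc_lt_succ.le
      have h2 := (hX i).2 k.castSucc k.castSucc le_rfl
      filter_upwards [condExp_sub ((hX i).integrable k.succ) ((hX i).integrable k.castSucc)
        (ℱ k.castSucc), h1, h2] with ω h3 h4 h5
      refine h3.trans ?_
      rw [Pi.sub_apply, h4, h5, sub_self, Pi.zero_apply]
    · filter_upwards [hk, hsucc k] with ω h1 h2
      simp only [Pi.sub_apply]
      rwa [← h2]
  have hnn : ∀ t, ∀ᵐ ω ∂μ, 0 ≤ V t ω := fun t => by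
    induction t using Fin.reverseInduction with
    | last => exact hT
    | cast k ih => filter_upwards [step k ih] with ω h using h.1
  have hzero : ∀ t, ∀ᵐ ω ∂μ, V t ω = 0 := fun t => by
    induction t using Fin.induction with
    | zero => exact hV0
    | succ k ih =>
      filter_upwards [step k (hnn _), ih, hsucc k] with ω h1 h2 h3
      rw [h3, h2, h1.2 h2, add_zero]
  exact hzero _

/-- An equivalent martingale measure for the discounted prices excludes arbitrage. -/
lemma satisfiesNA_of_isEMM {ι : Type*} [Fintype ι] {ℱ : Filtration (Fin (T + 1)) m}
    {P : Measure Ω} {S : ι → Fin (T + 1) → Ω → ℝ} (hS : ∀ i, StronglyAdapted ℱ (S i))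
    {B : Fin (T + 1) → Ω → ℝ} (hB : IsSavingsAccount ℱ B) {Q : @Measure Ω (ℱ (Fin.last T))}
    (hQ : IsEMM ℱ P (discounted S B) Q) : SatisfiesNA (sfOutcomes ℱ P (addAsset S B) 0) := by
  refine Set.eq_singleton_iff_unique_mem.2 ⟨⟨⟨0, ⟨fun i => ?_, fun t => ?_⟩, ?_, ?_⟩, ?_⟩, ?_⟩
  · exact isStronglyPredictable_iff.2 ⟨measurable_const, fun k => measurable_const⟩
  · exact ae_of_all _ fun ω => by simp [portfolio, stochInt]
  · exact ae_of_all _ fun ω => by simp [portfolio]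
  · filter_upwards [AEEqFun.coeFn_zero (β := ℝ)] with ω h
    rw [h]
    simp [portfolio]
  · exact le_rfl (α := Ω →ₘ[P] ℝ)
  · rintro f ⟨⟨δ, ⟨hδ, hsf⟩, h0, hf⟩, hf0⟩
    rw [Set.mem_ofPred_eq, ← AEEqFun.coeFn_le] at hf0
    have := hQ.prob
    have hδ' := fun i => isStronglyPredictable_iff.1 (hδ i)
    have hXm := measurable_discounted hS hB
    -- almost sure equations between terminal random variables pass from `P` to `Q`
    have htransfer : ∀ g : Ω → ℝ, Measurable[ℱ (Fin.last T)] g → (∀ᵐ ω ∂P, g ω = 0) →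
        ∀ᵐ ω ∂Q, g ω = 0 := fun g hg h => hQ.ac.ae_le
      ((hg.stronglyMeasurable.ae_eq_trim_iff (ℱ.le (Fin.last T)) stronglyMeasurable_const).2 h)
    let V : Fin (T + 1) → Ω → ℝ := fun t ω => portfolio (addAsset S B) δ t ω * (B t ω)⁻¹
    have hVm : ∀ t, Measurable[ℱ t] (V t) := fun t => by
      refine Measurable.mul ?_ (hB.measurable t).inv
      refine Finset.measurable_sum _ fun i _ => ((hδ i).stronglyAdapted t).measurable.mul ?_
      rcases i with _ | i
      · exact hB.measurable t
      · exact (hS i t).measurable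
    have hVlast : ∀ t, Measurable[ℱ (Fin.last T)] (V t) := fun t =>
      (hVm t).mono (ℱ.mono (Fin.le_last t)) le_rfl
    have hVT : ∀ᵐ ω ∂P, 0 ≤ V (Fin.last T) ω := by
      filter_upwards [hf, hf0, AEEqFun.coeFn_zero (β := ℝ)] with ω h1 h2 h3
      rw [h3, h1] at h2
      exact mul_nonneg h2 (inv_nonneg.2 (hB.pos _ ω).le)
    have hsucc : ∀ k : Fin T, ∀ᵐ ω ∂P, V k.succ ω - (V k.castSucc ω + ∑ i, δ (some i) k.succ ω *
        (discounted S B i k.succ ω - discounted S B i k.castSucc ω)) = 0 := by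
      intro k
      filter_upwards [hsf k.succ, hsf k.castSucc] with ω h1 h2
      have h3 := stochInt_succ δ (addAsset S B) k ω
      -- rebalancing at time `k` costs nothing
      have h4 : portfolio (addAsset S B) δ k.castSucc ω =
          δ none k.succ ω * B k.castSucc ω + ∑ i, δ (some i) k.succ ω * S i k.castSucc ω := by
        rw [Fintype.sum_option] at h3
        simp only [addAsset, mul_sub, Finset.sum_sub_distrib] at h3
        have h5 := portfolio_addAsset S B δ k.succ ω
        linarith
      have h6 := (hB.pos k.succ ω).ne'
      have h7 := (hB.pos k.castSucc ω).ne'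
      simp only [V, discounted]
      rw [h4, portfolio_addAsset]
      simp only [mul_sub, Finset.sum_sub_distrib, add_mul, mul_inv_cancel_right₀ h6,
        mul_inv_cancel_right₀ h7, Finset.sum_mul, mul_assoc]
      ring
    have hmain := ae_wealth_eq_zero hQ.martingale (ξ := fun i => δ (some i))
      (fun i k => (hδ' (some i)).2 k) (V := V) hVm ?_ (fun k => ?_) ?_
    · have hP : ∀ᵐ ω ∂P, V (Fin.last T) ω = 0 :=
        ae_of_ae_trim (ℱ.le (Fin.last T)) (hQ.ac_symm.ae_le hmain)
      refine AEEqFun.ext ?_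
      filter_upwards [hP, hf, AEEqFun.coeFn_zero (β := ℝ)] with ω h1 h2 h3
      rw [h2, h3]
      exact (mul_eq_zero.1 h1).resolve_right (inv_pos.2 (hB.pos _ ω)).ne'
    · refine htransfer _ (hVlast 0) ?_
      filter_upwards [h0] with ω h1
      simp [V, h1]
    · have hm : Measurable[ℱ (Fin.last T)] fun ω => V k.succ ω - (V k.castSucc ω +
          ∑ i, δ (some i) k.succ ω *
            (discounted S B i k.succ ω - discounted S B i k.castSucc ω)) := by
        refine (hVlast _).sub ((hVlast _).add (Finset.measurable_sum _ fun i _ => ?_))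
        exact (((hδ' (some i)).2 k).mono (ℱ.mono (Fin.le_last _)) le_rfl).mul
          (((hXm i _).mono (ℱ.mono (Fin.le_last _)) le_rfl).sub
            ((hXm i _).mono (ℱ.mono (Fin.le_last _)) le_rfl))
      filter_upwards [htransfer _ hm (hsucc k)] with ω h1
      linarith
    · exact hQ.ac.ae_le ((stronglyMeasurable_const.ae_le_trim_iff (ℱ.le (Fin.last T))
        (hVlast _).stronglyMeasurable).2 hVT)

end NoArbitrage

section Equivalence

variable {Ω : Type*} {m : MeasurableSpace Ω} {T : ℕ} {ι : Type*}

lemma exists_eq_const_of_eq_bot {F : MeasurableSpace Ω} (hF : F = ⊥) {f : Ω → ℝ}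
    (hf : StronglyMeasurable[F] f) : ∃ c, ∀ ω, f ω = c := by
  subst hF
  obtain ⟨c, hc⟩ := stronglyMeasurable_bot_iff.1 hf
  exact ⟨c, fun ω => congrFun hc ω⟩

lemma exists_isEMM_of_satisfiesNA [Fintype ι] {ℱ : Filtration (Fin (T + 1)) m}
    (hℱ : (ℱ 0 : MeasurableSpace Ω) = ⊥) {P : Measure Ω} [IsProbabilityMeasure P]
    {S : ι → Fin (T + 1) → Ω → ℝ} (hS : ∀ i, StronglyAdapted ℱ (S i))
    (hS_nonneg : ∀ i t, 0 ≤ᵐ[P] S i t) {B : Fin (T + 1) → Ω → ℝ} (hB : IsSavingsAccount ℱ B)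
    (hNA : SatisfiesNA (sfOutcomes ℱ P (addAsset S B) 0)) :
    ∃ Q : @Measure Ω (ℱ (Fin.last T)), IsEMM ℱ P (discounted S B) Q := by
  have hX := measurable_discounted hS hB
  obtain ⟨D, hD0, hD1, hD, hXD⟩ := exists_martingale_density hX
    (fun i t => by
      filter_upwards [hS_nonneg i t] with ω h using mul_nonneg h (inv_nonneg.2 (hB.pos t ω).le))
    (fun i => exists_eq_const_of_eq_bot hℱ (hX i 0).stronglyMeasurable)
    fun k ξ hξ => ae_gain_eq_zero_of_satisfiesNA hS hB hNA k hξ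
  obtain ⟨Q, hprob, hac, hac', hdens⟩ := exists_measure_of_martingale hD0 hD1 hD
  exact ⟨Q, hprob, hac, hac', fun i => (martingale_terminalFiltration_iff
    (fun t => (hD.stronglyMeasurable t).measurable) hD0 hdens
    fun t => (hX i t).stronglyMeasurable).2 (hXD i)⟩

/-- The deflator is `D B⁻¹` for the density process `D` of `Q`. -/
lemma exists_isEMD_of_isEMM {ℱ : Filtration (Fin (T + 1)) m} {P : Measure Ω}
    [IsProbabilityMeasure P] {S : ι → Fin (T + 1) → Ω → ℝ} (hS : ∀ i, StronglyAdapted ℱ (S i))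
    {B : Fin (T + 1) → Ω → ℝ} (hB : IsSavingsAccount ℱ B) {Q : @Measure Ω (ℱ (Fin.last T))}
    (hQ : IsEMM ℱ P (discounted S B) Q) :
    ∃ Z, IsEMD ℱ P S Z ∧ ∃ D C, IsMultiplicativeDecomposition ℱ P Z D C ∧ Martingale D ℱ P := by
  have := hQ.prob
  have hdens : ∀ t, ∃ D : Ω → ℝ, Measurable[ℱ t] D ∧ (∀ ω, 0 < D ω) ∧
      Q.trim (ℱ.mono (Fin.le_last t)) =
        (P.trim (ℱ.le t)).withDensity fun ω => ENNReal.ofReal (D ω) := fun t => by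
    have htrim : (P.trim (ℱ.le (Fin.last T))).trim (ℱ.mono (Fin.le_last t)) =
      P.trim (ℱ.le t) := trim_trim
    refine exists_pos_withDensity ?_ ?_
    · rw [← htrim]
      exact hQ.ac.trim _
    · rw [← htrim]
      exact hQ.ac_symm.trim _
  choose D hDm hD0 hD using hdens
  have hbayes := fun {M : Fin (T + 1) → Ω → ℝ} =>
    martingale_terminalFiltration_iff (P := P) (M := M) hDm hD0 hD
  have hDmart : Martingale D ℱ P := by
    simpa using (hbayes (M := fun _ _ => 1) fun t => stronglyMeasurable_const).1
      (martingale_const _ _ 1)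
  have hBinv : IsStronglyPredictable ℱ fun t ω => (B t ω)⁻¹ := by
    have h := isStronglyPredictable_iff.1 hB.predictable
    exact isStronglyPredictable_iff.2 ⟨h.1.inv, fun k => (h.2 k).inv⟩
  refine ⟨fun t ω => D t ω * (B t ω)⁻¹,
    ⟨fun t => ((hDm t).mul (hB.measurable t).inv).stronglyMeasurable,
      fun t ω => mul_pos (hD0 t ω) (inv_pos.2 (hB.pos t ω)), fun i => ?_⟩,
    D, fun t ω => (B t ω)⁻¹, ⟨Locally.of_prop hDmart, hD0, hBinv,
      fun t ω => inv_pos.2 (hB.pos t ω), fun t => ae_eq_rfl⟩, hDmart⟩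
  have h1 := (hbayes fun t => (measurable_discounted hS hB i t).stronglyMeasurable).1
    (hQ.martingale i)
  convert h1 using 3 with t ω
  simp only [discounted]
  ring

/-- The savings account is `C₀ / C`, and `Q` has the density process `D / D₀`. -/
lemma exists_isEMM_of_isEMD {ℱ : Filtration (Fin (T + 1)) m}
    (hℱ : (ℱ 0 : MeasurableSpace Ω) = ⊥) {P : Measure Ω} [IsProbabilityMeasure P]
    {S : ι → Fin (T + 1) → Ω → ℝ} (hS : ∀ i, StronglyAdapted ℱ (S i))
    {Z D C : Fin (T + 1) → Ω → ℝ} (hZ : IsEMD ℱ P S Z)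
    (hDC : IsMultiplicativeDecomposition ℱ P Z D C) (hD : Martingale D ℱ P) :
    ∃ B, IsSavingsAccount ℱ B ∧
      ∃ Q : @Measure Ω (ℱ (Fin.last T)), IsEMM ℱ P (discounted S B) Q := by
  have : Nonempty Ω := P.nonempty_of_neZero
  obtain ⟨ω₀⟩ := this
  have hC := isStronglyPredictable_iff.1 hDC.predictable
  obtain ⟨c, hc⟩ := exists_eq_const_of_eq_bot hℱ hC.1.stronglyMeasurable
  obtain ⟨d, hd⟩ := exists_eq_const_of_eq_bot hℱ (hD.stronglyMeasurable 0)
  have hc0 : 0 < c := hc ω₀ ▸ hDC.pos_right 0 ω₀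
  have hd0 : 0 < d := hd ω₀ ▸ hDC.pos_left 0 ω₀
  have hB : IsSavingsAccount ℱ fun t ω => c * (C t ω)⁻¹ :=
    ⟨isStronglyPredictable_iff.2 ⟨hC.1.inv.const_mul c, fun k => (hC.2 k).inv.const_mul c⟩,
      fun ω => by rw [hc, mul_inv_cancel₀ hc0.ne'],
      fun t ω => mul_pos hc0 (inv_pos.2 (hDC.pos_right t ω))⟩
  have hD0 : ∀ t ω, 0 < (d⁻¹ • D) t ω := fun t ω =>
    mul_pos (inv_pos.2 hd0) (hDC.pos_left t ω)
  have hD1 : ∀ ω, (d⁻¹ • D) 0 ω = 1 := fun ω => by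
    change d⁻¹ * D 0 ω = 1
    rw [hd, inv_mul_cancel₀ hd0.ne']
  have hDd : Martingale (d⁻¹ • D) ℱ P := hD.smul d⁻¹
  obtain ⟨Q, hprob, hac, hac', hdens⟩ := exists_measure_of_martingale hD0 hD1 hDd
  have hX := measurable_discounted hS hB
  refine ⟨_, hB, Q, hprob, hac, hac', fun i => (martingale_terminalFiltration_iff
    (fun t => (hDd.stronglyMeasurable t).measurable) hD0 hdens
    fun t => (hX i t).stronglyMeasurable).2 ?_⟩
  refine martingale_congr_ae ((hZ.martingale i).smul (c * d)⁻¹)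
    (fun t => (hX i t).stronglyMeasurable.mul (hDd.stronglyMeasurable t)) fun t => ?_
  filter_upwards [hDC.eq_mul t] with ω h
  have h1 := (hDC.pos_right t ω).ne'
  change (c * d)⁻¹ * (S i t ω * Z t ω) = S i t ω * (c * (C t ω)⁻¹)⁻¹ * (d⁻¹ * D t ω)
  rw [h]
  field_simp

end Equivalence

end DiscreteMarket

theorem mainTheorem5 {Ω : Type*} {m : MeasurableSpace Ω} (P : Measure Ω) [IsProbabilityMeasure P]
    {T d : ℕ} (ℱ : Filtration (Fin (T + 1)) m) (hℱ : (ℱ 0 : MeasurableSpace Ω) = ⊥)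
    (S : Fin d → Fin (T + 1) → Ω → ℝ) (hS : ∀ i, StronglyAdapted ℱ (S i))
    (hS_nonneg : ∀ i t, 0 ≤ᵐ[P] S i t) :
    List.TFAE [
      ∃ B, DiscreteMarket.IsSavingsAccount ℱ B ∧
        DiscreteMarket.SatisfiesNA
          (DiscreteMarket.sfOutcomes ℱ P (DiscreteMarket.addAsset S B) 0),
      ∃ Z, DiscreteMarket.IsEMD ℱ P S Z ∧
        ∃ D C, DiscreteMarket.IsMultiplicativeDecomposition ℱ P Z D C ∧ Martingale D ℱ P,
      ∃ B, DiscreteMarket.IsSavingsAccount ℱ B ∧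
        ∃ Q : @Measure Ω (ℱ (Fin.last T)),
          DiscreteMarket.IsEMM ℱ P (DiscreteMarket.discounted S B) Q] := by
  tfae_have 1 → 3 := fun ⟨B, hB, hNA⟩ =>
    ⟨B, hB, DiscreteMarket.exists_isEMM_of_satisfiesNA hℱ hS hS_nonneg hB hNA⟩
  tfae_have 3 → 2 := fun ⟨_, hB, _, hQ⟩ => DiscreteMarket.exists_isEMD_of_isEMM hS hB hQ
  tfae_have 2 → 3 := fun ⟨_, hZ, _, _, hDC, hD⟩ =>
    DiscreteMarket.exists_isEMM_of_isEMD hℱ hS hZ hDC hD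
  tfae_have 3 → 1 := fun ⟨B, hB, _, hQ⟩ => ⟨B, hB, DiscreteMarket.satisfiesNA_of_isEMM hS hB hQ⟩
  tfae_finish
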